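/- Let $\xi,\xi_1,\xi_2,\dots$ be independent identically distributed real random variables with $E\xi=0$ and $E\xi^2=1$, and suppose that $V(t):=P(\xi>t)=t^{-\alpha}L(t)$ for $t>0$, where $\alpha>2$ and $L$ is slowly varying at infinity (that is, $L(ty)/L(t)\to1$ as $t\to\infty$ for every $y>0$). Put $s_n:=\sqrt{(\alpha-2)\,n\ln n}$, let $(M_n)$ be a real sequence with $M_n/s_n\to\infty$ as $n\to\infty$, and put $Y_n:=\sum_{j=1}^n\min(\xi_j,M_n)$ and $\Pi_n:=nV(M_n)$. Let $W_0\equiv1$ and, for $m\ge1$ and $z\in(m-1,m)$, $$D_m(z):=\Big\{(t_1,\dots,t_m)\in\mathbb R^m:\ \max_{1\le j\le m}t_j<1,\ t_1+\dots+t_m>z\Big\},\qquad W_m(z):=\alpha^m\int_{D_m(z)}(t_1\cdots t_m)^{-\alpha-1}\,dt_1\cdots dt_m .$$ Then for every fixed integer $k\ge2$ there is a positive sequence $(h_{k,n})_{n}$ with $h_{k,n}\to0$ as $n\to\infty$ such that $$P(Y_n>x)\sim\frac{\Pi_n^k}{k!}\sum_{j=0}^k\binom kj W_{k-j}\Big(\frac{x}{M_n}-j\Big),\qquad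 n\to\infty,$$ uniformly in $x\in\big((k-1+h_{k,n})M_n,\,(k-h_{k,n})M_n\big)$, that is, the supremum over these $x$ of $|\text{left side}/\text{right side}-1|$ tends to $0$. It is enough that the sequence vanishes slowly: the same holds with $(h_{k,n})$ replaced by any sequence $(h_n)$ such that $h_n\to0$ and $h_n\ge h_{k,n}$ for all large $n$. -/

import Mathlib

open MeasureTheory ProbabilityTheory Filter Topology

noncomputable section

/-- `L` is slowly varying at infinity: `L (t y) / L t → 1` as `t → ∞`, for every `y > 0`. -/
def SlowlyVarying (L : ℝ → ℝ) : Prop :=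
  ∀ y : ℝ, 0 < y → Tendsto (fun t : ℝ => L (t * y) / L t) atTop (𝓝 1)

/-- The right tail `V t = P (X > t)` of a random variable. -/
def rightTail {Ω : Type*} [MeasurableSpace Ω] (P : Measure Ω) (X : Ω → ℝ) (t : ℝ) : ℝ :=
  P.real {ω | t < X ω}

/-- `s_n = ((α - 2) n log n) ^ (1 / 2)`. -/
def sScale (α : ℝ) (n : ℕ) : ℝ :=
  Real.sqrt ((α - 2) * n * Real.log n)

/-- The sum of the first `n` of the variables `ξ 0, ξ 1, …`, each censored at the level `M`. -/
def censoredSum {Ω : Type*} (ξ : ℕ → Ω → ℝ) (M : ℝ) (n : ℕ) (ω : Ω) : ℝ :=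
  ∑ j ∈ Finset.range n, min (ξ j ω) M

/-- `D_m(z)`: the points `t` of `ℝ ^ m` with all `t_j < 1` and `t_1 + ⋯ + t_m > z`. -/
def simplexD (m : ℕ) (z : ℝ) : Set (Fin m → ℝ) :=
  {t | (∀ j, t j < 1) ∧ z < ∑ j, t j}

/-- `W_0 = 1`, and `W_m(z)` is `α ^ m` times the integral of `(t_1 ⋯ t_m) ^ (-α - 1)` over
`D_m(z)` for `m ≥ 1`. It is meant (and only used) for `m - 1 < z < m`. -/
def simplexW (α : ℝ) (m : ℕ) (z : ℝ) : ℝ :=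
  if m = 0 then 1
  else α ^ m * ∫ t in simplexD m z, (∏ j, t j) ^ (-α - 1)

/-- `f n x ∼ g n x` as `n → ∞`, uniformly in `x ∈ S n`: the supremum over `x ∈ S n` of
`|f n x / g n x - 1|` tends to `0`. -/
def UniformlyEquivalent (f g : ℕ → ℝ → ℝ) (S : ℕ → Set ℝ) : Prop :=
  ∀ ε : ℝ, 0 < ε → ∀ᶠ n : ℕ in atTop, ∀ x ∈ S n, |f n x / g n x - 1| ≤ ε

end

/-! Write `x = z * M n` with `k - 1 < z < k`. No censored summand exceeds `M n`, so fewer than `k`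
summands of order `M n` cannot carry the sum past `x` unless the small ones add up to order `M n`.
The dominant scenario is therefore exactly `k` large summands and a remainder of size `o(M n)`.
There are about `n ^ k / k!` choices of the `k` indices. For a fixed choice the probability is the
mass that the `k`-fold product of the law of `min (ξ / M) 1` gives to a half-space
(`measureReal_lt_sum_min_eq`).

Divided by `V (M n)`, that law converges away from `0` to the density `α t ^ (-α - 1)` on `(0, 1)`
plus a unit atom at `1` created by the censoring. Expanding the product by the number `j` of
coordinates sitting at the atom gives the binomial sum of the `W_{k-j}(z - j)` (`sumTail_add_dirac`,
`tendsto_sumTail_div_pow`).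

For the upper bound, a Chernoff estimate with parameter of order `log M / M` shows that summands
truncated at a small multiple of `M n` exceed `ε M n` with probability below any power of `M n`,
whereas `Π_n ^ k` decays at most like a power. More than `k` large summands cost `Π_n ^ (k + 1)`.
For the lower bound, Chebyshev's inequality controls the remainder. This gives
`tendsto_normalizedTail` for each fixed `z`.

Uniformity comes from monotonicity in `z` and continuity of the limit, which give uniform
convergence on compact subintervals; a diagonal choice lets these grow to the whole interval. The
limit is at least `1`, so absolute errors bound relative ones. -/

open scoped ENNReal

/-! ### Diagonal extraction and uniform convergence of monotone functions. -/

/-- A diagonal extraction: a countable family of eventual properties holds along some index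
sequence tending to infinity. -/
theorem exists_tendsto_atTop_eventually_diagonal {p : ℕ → ℕ → Prop}
    (h : ∀ i, ∀ᶠ n in atTop, p i n) :
    ∃ i : ℕ → ℕ, Tendsto i atTop atTop ∧ ∀ᶠ n in atTop, p (i n) n := by
  classical
  let q : ℕ → ℕ → Prop := fun n i => ∀ m, n ≤ m → p i m
  have hq : ∀ i, ∀ᶠ n in atTop, i ≤ n ∧ q n i := by
    intro i
    obtain ⟨N, hN⟩ := eventually_atTop.1 (h i)
    filter_upwards [eventually_ge_atTop (max i N)] with n hn
    exact ⟨le_trans (le_max_left _ _) hn,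
      fun m hm => hN m (le_trans (le_trans (le_max_right _ _) hn) hm)⟩
  refine ⟨fun n => Nat.findGreatest (q n) n, tendsto_atTop.2 fun b => ?_, ?_⟩
  · filter_upwards [hq b] with n hn
    exact Nat.le_findGreatest hn.1 hn.2
  · filter_upwards [hq 0] with n hn
    exact Nat.findGreatest_spec hn.1 hn.2 n le_rfl

/-- Antitone functions converging pointwise on an open interval to a continuous function converge
uniformly on compact subintervals. -/
theorem tendstoUniformlyOn_Icc_of_antitone {F : ℕ → ℝ → ℝ} {G : ℝ → ℝ} {c d a b : ℝ}
    (hF : ∀ᶠ n in atTop, Antitone (F n))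
    (hlim : ∀ z ∈ Set.Ioo c d, Tendsto (fun n => F n z) atTop (𝓝 (G z)))
    (hG : ContinuousOn G (Set.Ioo c d)) (hca : c < a) (hbd : b < d) :
    TendstoUniformlyOn F G atTop (Set.Icc a b) := by
  rw [← tendstoLocallyUniformlyOn_iff_tendstoUniformlyOn_of_compact isCompact_Icc,
    Metric.tendstoLocallyUniformlyOn_iff]
  intro ε hε x hx
  have hxm : x ∈ Set.Ioo c d := ⟨hca.trans_le hx.1, hx.2.trans_lt hbd⟩
  have hGx : ContinuousAt G x := hG.continuousAt (isOpen_Ioo.mem_nhds hxm)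
  obtain ⟨r, hr, hrG⟩ := Metric.continuousAt_iff.1 hGx (ε / 3) (by positivity)
  obtain ⟨r', hr', hrI⟩ := Metric.isOpen_iff.1 isOpen_Ioo x hxm
  set t := min r r' / 2 with ht
  have ht0 : 0 < t := by positivity
  have htr : t < r := by
    have := min_le_left r r'
    have := lt_min hr hr'
    linarith
  have htr' : t < r' := by
    have := min_le_right r r'
    have := lt_min hr hr'
    linarith
  have hclose : ∀ y, |y - x| ≤ t → |G y - G x| < ε / 3 ∧ y ∈ Set.Ioo c d := by
    intro y hy
    exact ⟨hrG (by rw [Real.dist_eq]; linarith), hrI (by rw [Metric.mem_ball, Real.dist_eq]; linarith)⟩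
  obtain ⟨hu, hum⟩ := hclose (x - t) (by rw [sub_sub_cancel_left, abs_neg, abs_of_pos ht0])
  obtain ⟨hv, hvm⟩ := hclose (x + t) (by rw [add_sub_cancel_left, abs_of_pos ht0])
  refine ⟨Set.Icc (x - t) (x + t), mem_nhdsWithin_of_mem_nhds
    (Icc_mem_nhds (by linarith) (by linarith)), ?_⟩
  -- Antitonicity squeezes `F n y` between its values at `x - t` and `x + t`, so convergence at
  -- these two points suffices; three errors of `ε / 3` add up.
  filter_upwards [hF, Metric.tendsto_nhds.1 (hlim _ hum) (ε / 3) (by positivity),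
    Metric.tendsto_nhds.1 (hlim _ hvm) (ε / 3) (by positivity)] with n hn h1 h2 y hy
  have h3 := hn hy.1
  have h4 := hn hy.2
  obtain ⟨h5, -⟩ := hclose y (abs_le.2 ⟨by linarith [hy.1], by linarith [hy.2]⟩)
  rw [Real.dist_eq] at h1 h2 ⊢
  rw [abs_lt] at *
  constructor <;> linarith [h1.1, h1.2, h2.1, h2.2, h5.1, h5.2, hu.1, hu.2, hv.1, hv.2]

/-! ### Power bounds for regularly varying tails. -/

/-- A function that does not increase under doubling is bounded by its bound on one dyadic
block. -/
theorem le_of_doubling_le {g : ℝ → ℝ} {t₀ C : ℝ} (ht₀ : 0 < t₀)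
    (hstep : ∀ t, t₀ ≤ t → g (2 * t) ≤ g t)
    (hbase : ∀ t, t₀ ≤ t → t ≤ 2 * t₀ → g t ≤ C) : ∀ t, t₀ ≤ t → g t ≤ C := by
  have key : ∀ m : ℕ, ∀ t, t₀ ≤ t → t ≤ 2 ^ (m + 1) * t₀ → g t ≤ C := by
    intro m
    induction m with
    | zero => intro t h1 h2; exact hbase t h1 (by simpa using h2)
    | succ m ih =>
      intro t h1 h2
      by_cases h : t ≤ 2 * t₀
      · exact hbase t h1 h
      · have h3 := hstep (t / 2) (by linarith)
        rw [mul_div_cancel₀ _ (two_ne_zero)] at h3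
        refine h3.trans (ih _ (by linarith) ?_)
        rw [pow_succ] at h2
        linarith
  intro t ht
  obtain ⟨m, hm⟩ := pow_unbounded_of_one_lt (t / t₀) (one_lt_two : (1 : ℝ) < 2)
  refine key m t ht ?_
  rw [div_lt_iff₀ ht₀] at hm
  have : (2 : ℝ) ^ m * t₀ ≤ 2 ^ (m + 1) * t₀ := by
    gcongr
    · norm_num
    · omega
  linarith

/-- A Potter-type bound. For `γ` strictly between `β` and `α`, the function `f t * t ^ γ` eventually
does not increase under doubling, hence stays bounded; the spare power `t ^ (γ - β)` absorbs the
constant. -/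
theorem eventually_le_rpow_of_doubling {f : ℝ → ℝ} {α β : ℝ} (hf : Antitone f)
    (hpos : ∀ t, 0 < t → 0 < f t)
    (hlim : Tendsto (fun t => f (t * 2) / f t) atTop (𝓝 ((2 : ℝ) ^ (-α)))) (hβ0 : 0 < β)
    (hβ : β < α) : ∀ᶠ t in atTop, f t ≤ t ^ (-β) := by
  obtain ⟨γ, hγ1, hγ2⟩ := exists_between hβ
  have h1 : (2 : ℝ) ^ (-α) < 2 ^ (-γ) := Real.rpow_lt_rpow_of_exponent_lt one_lt_two (by linarith)
  obtain ⟨t₀, ht₀, hstep⟩ : ∃ t₀ : ℝ, 0 < t₀ ∧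
      ∀ t, t₀ ≤ t → f (t * 2) / f t < 2 ^ (-γ) := by
    obtain ⟨a, ha⟩ := eventually_atTop.1 (hlim.eventually (gt_mem_nhds h1))
    exact ⟨max a 1, by positivity, fun t ht => ha t (le_trans (le_max_left _ _) ht)⟩
  have hb := le_of_doubling_le (g := fun t => f t * t ^ γ) (C := f t₀ * (2 * t₀) ^ γ) ht₀ (by
      intro t ht
      have h0 : 0 < t := ht₀.trans_le ht
      have h2 := hstep t ht
      rw [div_lt_iff₀ (hpos t h0), Real.rpow_neg two_pos.le] at h2
      rw [Real.mul_rpow two_pos.le h0.le, mul_comm 2 t]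
      have h3 : (0 : ℝ) < 2 ^ γ := by positivity
      have h4 : f (t * 2) * 2 ^ γ ≤ f t := by
        calc f (t * 2) * 2 ^ γ ≤ ((2 ^ γ)⁻¹ * f t) * 2 ^ γ := by gcongr
          _ = f t := by field_simp
      calc f (t * 2) * (2 ^ γ * t ^ γ) = f (t * 2) * 2 ^ γ * t ^ γ := by ring
        _ ≤ f t * t ^ γ := by gcongr)
    (by
      intro t h2 h3
      have h0 : 0 < t := ht₀.trans_le h2
      have := hf h2
      have := hpos t₀ ht₀
      gcongr
      linarith)
  have hC := tendsto_rpow_atTop (sub_pos.2 hγ1)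
  filter_upwards [hC.eventually_ge_atTop (f t₀ * (2 * t₀) ^ γ), eventually_ge_atTop t₀] with t h2 h3
  have h0 : 0 < t := ht₀.trans_le h3
  have h4 := (hb t h3).trans h2
  have h5 : t ^ (-β) = t ^ (γ - β) * t ^ (-γ) := by rw [← Real.rpow_add h0]; ring_nf
  have h6 : f t = f t * t ^ γ * t ^ (-γ) := by
    rw [mul_assoc, ← Real.rpow_add h0]; simp
  rw [h5, h6]
  gcongr

/-- The mirror image: with `α < γ < β`, the doubling argument is applied to `-(f t * t ^ γ)`. -/
theorem eventually_rpow_le_of_doubling {f : ℝ → ℝ} {α β : ℝ} (hf : Antitone f)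
    (hpos : ∀ t, 0 < t → 0 < f t)
    (hlim : Tendsto (fun t => f (t * 2) / f t) atTop (𝓝 ((2 : ℝ) ^ (-α)))) (hα : 0 < α)
    (hβ : α < β) : ∀ᶠ t in atTop, t ^ (-β) ≤ f t := by
  obtain ⟨γ, hγ1, hγ2⟩ := exists_between hβ
  have h1 : (2 : ℝ) ^ (-γ) < 2 ^ (-α) := Real.rpow_lt_rpow_of_exponent_lt one_lt_two (by linarith)
  obtain ⟨t₀, ht₀, hstep⟩ : ∃ t₀ : ℝ, 0 < t₀ ∧
      ∀ t, t₀ ≤ t → 2 ^ (-γ) < f (t * 2) / f t := by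
    obtain ⟨a, ha⟩ := eventually_atTop.1 (hlim.eventually (lt_mem_nhds h1))
    exact ⟨max a 1, by positivity, fun t ht => ha t (le_trans (le_max_left _ _) ht)⟩
  have hb := le_of_doubling_le (g := fun t => -(f t * t ^ γ)) (C := -(f (2 * t₀) * t₀ ^ γ)) ht₀ (by
      intro t ht
      have h0 : 0 < t := ht₀.trans_le ht
      have h2 := hstep t ht
      rw [lt_div_iff₀ (hpos t h0), Real.rpow_neg two_pos.le] at h2
      simp only [neg_le_neg_iff]
      rw [Real.mul_rpow two_pos.le h0.le, mul_comm 2 t]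
      have h3 : (0 : ℝ) < 2 ^ γ := by positivity
      have h4 : f t ≤ f (t * 2) * 2 ^ γ := by
        calc f t = ((2 ^ γ)⁻¹ * f t) * 2 ^ γ := by field_simp
          _ ≤ f (t * 2) * 2 ^ γ := by gcongr
      calc f t * t ^ γ ≤ f (t * 2) * 2 ^ γ * t ^ γ := by gcongr
        _ = f (t * 2) * (2 ^ γ * t ^ γ) := by ring)
    (by
      intro t h2 h3
      have h0 : 0 < t := ht₀.trans_le h2
      have := hf h3
      have := hpos t h0
      simp only [neg_le_neg_iff]
      have hγ : 0 ≤ γ := by linarith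
      gcongr)
  have hc : 0 < f (2 * t₀) * t₀ ^ γ := by
    have := hpos (2 * t₀) (by positivity)
    positivity
  have hC := tendsto_rpow_neg_atTop (sub_pos.2 hγ2)
  filter_upwards [hC.eventually (gt_mem_nhds hc), eventually_ge_atTop t₀] with t h2 h3
  have h0 : 0 < t := ht₀.trans_le h3
  have h4 := h2.le.trans (neg_le_neg_iff.1 (hb t h3))
  have h5 : t ^ (-β) = t ^ (-(β - γ)) * t ^ (-γ) := by rw [← Real.rpow_add h0]; ring_nf
  have h6 : f t = f t * t ^ γ * t ^ (-γ) := by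
    rw [mul_assoc, ← Real.rpow_add h0]; simp
  rw [h5, h6]
  gcongr

/-- Division by zero yields `0`, so a zero of `L` would keep the quotient away from its limit `1`.
-/
theorem SlowlyVarying.eventually_ne_zero {L : ℝ → ℝ} (hL : SlowlyVarying L) :
    ∀ᶠ t in atTop, L t ≠ 0 := by
  filter_upwards [(hL 2 two_pos).eventually (lt_mem_nhds one_pos)] with t ht h0
  simp [h0] at ht

/-- If `V t = t ^ (-α) L t` with `L` slowly varying, then `V` is regularly varying of
index `-α`. -/
theorem SlowlyVarying.tendsto_tail_ratio {V L : ℝ → ℝ} {α : ℝ} (hL : SlowlyVarying L)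
    (hV : ∀ t, 0 < t → V t = t ^ (-α) * L t) {y : ℝ} (hy : 0 < y) :
    Tendsto (fun t => V (t * y) / V t) atTop (𝓝 (y ^ (-α))) := by
  have h := (hL y hy).const_mul (y ^ (-α))
  rw [mul_one] at h
  refine h.congr' ?_
  filter_upwards [eventually_gt_atTop 0] with t ht
  have h0 : t ^ (-α) ≠ 0 := (Real.rpow_pos_of_pos ht _).ne'
  rw [hV t ht, hV _ (mul_pos ht hy), Real.mul_rpow ht.le hy.le, mul_assoc,
    mul_div_mul_left _ _ h0, mul_div_assoc]

theorem SlowlyVarying.tail_pos {V L : ℝ → ℝ} {α : ℝ} (hL : SlowlyVarying L)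
    (hV : ∀ t, 0 < t → V t = t ^ (-α) * L t) (hanti : Antitone V) (h0 : ∀ t, 0 ≤ V t) (t : ℝ) :
    0 < V t := by
  obtain ⟨u, hu, htu, hu0⟩ := (hL.eventually_ne_zero.and
    ((eventually_ge_atTop t).and (eventually_gt_atTop 0))).exists
  have h1 : 0 < V u := lt_of_le_of_ne (h0 u) (by
    rw [hV u hu0]
    exact (mul_ne_zero (Real.rpow_pos_of_pos hu0 _).ne' hu).symm)
  exact h1.trans_le (hanti htu)

/-! ### Growth of the censoring level. -/

theorem tendsto_sScale_atTop {α : ℝ} (hα : 2 < α) : Tendsto (sScale α) atTop atTop := by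
  have h1 : Tendsto (fun n : ℕ => (n : ℝ) * Real.log n) atTop atTop :=
    tendsto_natCast_atTop_atTop.atTop_mul_atTop₀
      (Real.tendsto_log_atTop.comp tendsto_natCast_atTop_atTop)
  have h2 := h1.const_mul_atTop (sub_pos.2 hα)
  refine Real.tendsto_sqrt_atTop.comp (h2.congr fun n => ?_)
  ring

theorem tendsto_level_atTop {α : ℝ} (hα : 2 < α) {M : ℕ → ℝ}
    (hM : Tendsto (fun n => M n / sScale α n) atTop atTop) : Tendsto M atTop atTop := by
  refine (hM.atTop_mul_atTop₀ (tendsto_sScale_atTop hα)).congr' ?_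
  filter_upwards [(tendsto_sScale_atTop hα).eventually_gt_atTop 0] with n hn
  field_simp

/-- The hypothesis controls `n log n / M ^ 2`. If `M ≤ n` then `log M ≤ log n`; otherwise `n log M /
M ^ 2` is at most `log M / M`. The sum of the two bounds covers both cases. -/
theorem tendsto_mul_log_div_sq {α : ℝ} (hα : 2 < α) {M : ℕ → ℝ}
    (hM : Tendsto (fun n => M n / sScale α n) atTop atTop) :
    Tendsto (fun n : ℕ => n * Real.log (M n) / M n ^ 2) atTop (𝓝 0) := by
  have hMt := tendsto_level_atTop hα hM
  have h1 : Tendsto (fun n : ℕ => (n : ℝ) * Real.log n / M n ^ 2) atTop (𝓝 0) := by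
    have h2 : Tendsto (fun n => (α - 2)⁻¹ * ((M n / sScale α n) ^ 2)⁻¹) atTop (𝓝 0) := by
      have := (((tendsto_pow_atTop two_ne_zero).comp hM).inv_tendsto_atTop).const_mul (α - 2)⁻¹
      simpa using this
    refine h2.congr' ?_
    filter_upwards [eventually_ge_atTop 2, (tendsto_sScale_atTop hα).eventually_gt_atTop 0,
      hMt.eventually_gt_atTop 0] with n hn hs hm
    have h3 : sScale α n ^ 2 = (α - 2) * n * Real.log n := by
      refine Real.sq_sqrt ?_
      have : 0 ≤ Real.log n := Real.log_natCast_nonneg n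
      have : 0 < α - 2 := by linarith
      positivity
    have h4 : (α - 2) ≠ 0 := by linarith
    rw [div_pow, inv_div, h3]
    field_simp
  have h2 : Tendsto (fun n => Real.log (M n) / M n) atTop (𝓝 0) := by
    have := (Real.isLittleO_log_id_atTop.tendsto_div_nhds_zero).comp hMt
    exact this
  have h3 := h1.add h2
  rw [add_zero] at h3
  refine squeeze_zero' ?_ ?_ h3
  · filter_upwards [hMt.eventually_ge_atTop 1] with n hn
    have := Real.log_nonneg hn
    positivity
  · filter_upwards [hMt.eventually_ge_atTop 1, eventually_ge_atTop 1] with n hn hn1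
    have hl := Real.log_nonneg hn
    have hl2 : 0 ≤ Real.log n := Real.log_natCast_nonneg n
    have hm0 : 0 < M n := by linarith
    rcases le_total (M n) n with h | h
    · have h4 : Real.log (M n) ≤ Real.log n := Real.log_le_log hm0 h
      have h5 : n * Real.log (M n) / M n ^ 2 ≤ n * Real.log n / M n ^ 2 := by gcongr
      have : 0 ≤ Real.log (M n) / M n := by positivity
      linarith
    · have h5 : n * Real.log (M n) / M n ^ 2 ≤ M n * Real.log (M n) / M n ^ 2 := by gcongr
      have h6 : M n * Real.log (M n) / M n ^ 2 = Real.log (M n) / M n := by field_simp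
      have : 0 ≤ n * Real.log n / M n ^ 2 := by positivity
      linarith

theorem tendsto_natCast_div_sq {α : ℝ} (hα : 2 < α) {M : ℕ → ℝ}
    (hM : Tendsto (fun n => M n / sScale α n) atTop atTop) :
    Tendsto (fun n : ℕ => n / M n ^ 2) atTop (𝓝 0) := by
  have hMt := tendsto_level_atTop hα hM
  refine squeeze_zero' (Eventually.of_forall fun n => by positivity) ?_
    (tendsto_mul_log_div_sq hα hM)
  filter_upwards [(Real.tendsto_log_atTop.comp hMt).eventually_ge_atTop 1] with n hn
  simp only [Function.comp] at hn
  gcongr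
  exact le_mul_of_one_le_right (by positivity) hn

/-! ### Half-space masses of product measures. -/

/-- The mass that the `m`-fold product of `ν` gives to the half-space `t_1 + ⋯ + t_m > z`. -/
noncomputable def sumTail (ν : Measure ℝ) (m : ℕ) (z : ℝ) : ℝ≥0∞ :=
  Measure.pi (fun _ : Fin m => ν) {t | z < ∑ j, t j}

theorem measurableSet_lt_sum (m : ℕ) (z : ℝ) : MeasurableSet {t : Fin m → ℝ | z < ∑ j, t j} :=
  measurableSet_lt measurable_const (by fun_prop)

theorem antitone_sumTail (ν : Measure ℝ) (m : ℕ) : Antitone (sumTail ν m) :=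
  fun _ _ h => measure_mono fun _ ht => h.trans_lt ht

/-- Separates coordinate `0` by Tonelli. The set `A` is general because both half-lines and single
points are needed. -/
theorem pi_succ_sum_preimage (ν : Measure ℝ) [SigmaFinite ν] (m : ℕ) {A : Set ℝ}
    (hA : MeasurableSet A) :
    Measure.pi (fun _ : Fin (m + 1) => ν) {t | ∑ j, t j ∈ A} =
      ∫⁻ s, Measure.pi (fun _ : Fin m => ν) {t | s + ∑ j, t j ∈ A} ∂ν := by
  have h := measurePreserving_piFinSuccAbove (fun _ : Fin (m + 1) => ν) 0
  have hB : MeasurableSet {p : ℝ × (Fin m → ℝ) | p.1 + ∑ j, p.2 j ∈ A} :=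
    measurableSet_preimage (by fun_prop) hA
  have h1 := h.measure_preimage hB.nullMeasurableSet
  rw [Measure.prod_apply hB] at h1
  refine Eq.trans ?_ h1
  congr 1
  ext t
  simp [Fin.sum_univ_succ, MeasurableEquiv.piFinSuccAbove, Fin.tail, Fin.insertNthEquiv]

theorem sumTail_zero (ν : Measure ℝ) (z : ℝ) : sumTail ν 0 z = if z < 0 then 1 else 0 := by
  rw [sumTail, Measure.pi_of_empty]
  split_ifs with h <;> simp [h]

theorem sumTail_succ (ν : Measure ℝ) [SigmaFinite ν] (m : ℕ) (z : ℝ) :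
    sumTail ν (m + 1) z = ∫⁻ s, sumTail ν m (z - s) ∂ν := by
  have h := pi_succ_sum_preimage ν m (measurableSet_Ioi (a := z))
  simp only [Set.mem_Ioi] at h
  simp only [sumTail, h, sub_lt_iff_lt_add']

theorem measurable_sumTail_sub (ν : Measure ℝ) (m : ℕ) (z : ℝ) :
    Measurable fun s => sumTail ν m (z - s) :=
  (antitone_sumTail ν m).measurable.comp (measurable_const.sub measurable_id)

theorem sumTail_smul (ν : Measure ℝ) [IsFiniteMeasure ν] {c : ℝ≥0∞} (hc : c ≠ ∞) (m : ℕ) (z : ℝ) :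
    sumTail (c • ν) m z = c ^ m * sumTail ν m z := by
  have : IsFiniteMeasure (c • ν) := Measure.smul_finite ν hc
  induction m generalizing z with
  | zero => simp [sumTail_zero]
  | succ m ih =>
    simp_rw [sumTail_succ, lintegral_smul_measure, ih]
    rw [lintegral_const_mul _ (measurable_sumTail_sub ν m z), smul_eq_mul, pow_succ]
    ring

/-- Adding an atom at `1` expands the product measures binomially. -/
theorem sumTail_add_dirac (ν : Measure ℝ) [IsFiniteMeasure ν] (m : ℕ) (z : ℝ) :
    sumTail (ν + Measure.dirac 1) m z =
      ∑ p ∈ Finset.HasAntidiagonal.antidiagonal m, (m.choose p.1 : ℝ≥0∞) * sumTail ν p.2 (z - p.1) := by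
  induction m generalizing z with
  | zero => simp [sumTail_zero]
  | succ m ih =>
    -- Pascal's rule: the new coordinate is either drawn from `ν`, adding a factor, or sits at the
    -- atom, shifting `z` by `1`.
    have h := Finset.sum_antidiagonal_choose_succ_mul
      (fun i j => sumTail ν j (z - (i : ℝ))) m
    rw [h, sumTail_succ, lintegral_add_measure, lintegral_dirac' _ (measurable_sumTail_sub _ m z)]
    simp_rw [ih]
    have hcomm : ∀ p : ℕ × ℕ, (fun s => sumTail ν p.2 (z - s - p.1)) =
        fun s => sumTail ν p.2 (z - p.1 - s) := fun p => by
      funext s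
      rw [sub_right_comm]
    have hmeas : ∀ p : ℕ × ℕ, Measurable fun s => sumTail ν p.2 (z - s - p.1) := fun p => by
      rw [hcomm]
      exact measurable_sumTail_sub _ _ _
    rw [lintegral_finsetSum _ fun p _ => (hmeas p).const_mul _]
    congr 1
    · refine Finset.sum_congr rfl fun p _ => ?_
      rw [lintegral_const_mul _ (hmeas p), hcomm, sumTail_succ]
    · refine Finset.sum_congr rfl fun p hp => ?_
      rw [Finset.HasAntidiagonal.mem_antidiagonal] at hp
      rw [← Nat.choose_symm_of_eq_add hp.symm, Nat.cast_add, Nat.cast_one, sub_sub, add_comm 1]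

/-- Points below `η` do not contribute to a sum of `m` terms `≤ 1` exceeding `m - 1 + η`. -/
theorem sumTail_restrict (ν : Measure ℝ) [IsFiniteMeasure ν] (h1 : ν (Set.Ioi 1) = 0) {η z : ℝ}
    {m : ℕ} (hz : (m : ℝ) - 1 + η ≤ z) :
    sumTail (ν.restrict (Set.Ioi η)) m z = sumTail ν m z := by
  unfold sumTail
  rw [← Measure.restrict_pi_pi, Measure.restrict_apply (measurableSet_lt_sum m z)]
  refine measure_congr ?_
  have hae : ∀ᵐ t ∂(Measure.pi fun _ : Fin m => ν), ∀ i, t i ≤ 1 := by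
    refine eventually_all.2 fun i => ?_
    have h2 : ∀ᵐ s ∂ν, s ≤ 1 := by
      simp only [ae_iff, not_le]; exact h1
    exact (Measure.tendsto_eval_ae_ae (μ := fun _ : Fin m => ν) (i := i)).eventually h2
  filter_upwards [hae] with t ht
  refine propext ⟨fun h => h.1, fun h => ⟨h, fun i _ => ?_⟩⟩
  have h3 : ∑ j ∈ Finset.univ.erase i, t j ≤ (m - 1 : ℕ) := by
    refine (Finset.sum_le_card_nsmul _ _ 1 fun j _ => ht j).trans ?_
    simp [Finset.card_erase_of_mem]
  have h4 := Finset.add_sum_erase Finset.univ t (Finset.mem_univ i)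
  have h5 : z < ∑ j, t j := h
  have hm : 1 ≤ m := Nat.one_le_iff_ne_zero.2 (by rintro rfl; exact i.elim0)
  rw [Nat.cast_sub hm, Nat.cast_one] at h3
  simp only [Set.mem_Ioi]
  linarith

/-- The sum of coordinates has no atoms off the integers if `1` is the only atom of `ν`. -/
theorem pi_sum_eq_null {ν : Measure ℝ} [SigmaFinite ν] (hν : ∀ x, x ≠ 1 → ν {x} = 0) (m : ℕ)
    {z : ℝ} (hz : ∀ j : ℕ, z ≠ j) :
    Measure.pi (fun _ : Fin m => ν) {t | ∑ j, t j = z} = 0 := by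
  induction m generalizing z with
  | zero =>
    have := hz 0
    rw [Measure.pi_of_empty]
    simpa using this.symm
  | succ m ih =>
    have h := pi_succ_sum_preimage ν m (measurableSet_singleton z)
    simp only [Set.mem_singleton_iff] at h
    rw [h]
    have hae : ∀ᵐ s ∂ν, ∀ j : ℕ, z - s ≠ j := by
      refine ae_all_iff.2 fun j => ?_
      rw [ae_iff]
      -- The excluded point is not the atom: `z - j = 1` would make `z` the natural number `j + 1`.
      refine measure_mono_null ?_ (hν (z - j) fun h1 => hz (j + 1) (by push_cast; linarith))
      intro s hs
      simp only [not_not, Set.mem_ofPred_eq] at hs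
      simp only [Set.mem_singleton_iff]
      linarith
    rw [lintegral_congr_ae (g := fun _ => 0), lintegral_zero]
    filter_upwards [hae] with s hs
    rw [← ih hs]
    congr 1
    ext t
    simp only [Set.mem_ofPred_eq]
    exact ⟨fun h => by linarith, fun h => by linarith⟩

/-- Convergence is demanded at every `t`, atoms included, so it passes to all half-open intervals;
these form a π-system with small neighbourhoods of every point. -/
theorem tendsto_probabilityMeasure_of_tendsto_Ioi {μ : ℕ → ProbabilityMeasure ℝ}
    {ν : ProbabilityMeasure ℝ}
    (h : ∀ t, Tendsto (fun n => (μ n : Measure ℝ).real (Set.Ioi t)) atTop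
      (𝓝 ((ν : Measure ℝ).real (Set.Ioi t)))) :
    Tendsto μ atTop (𝓝 ν) := by
  refine IsPiSystem.tendsto_probabilityMeasure_of_tendsto_of_mem
    (S := {s | ∃ a b : ℝ, s = Set.Ioc a b}) ?_ ?_ ?_ ?_
  · rintro _ ⟨a, b, rfl⟩ _ ⟨c, d, rfl⟩ -
    exact ⟨_, _, Set.Ioc_inter_Ioc⟩
  · rintro _ ⟨a, b, rfl⟩
    exact measurableSet_Ioc
  · intro u hu x hx
    obtain ⟨ε, hε, hsub⟩ := Metric.isOpen_iff.1 hu x hx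
    refine ⟨_, ⟨x - ε / 2, x + ε / 2, rfl⟩, Ioc_mem_nhds (by linarith) (by linarith), ?_⟩
    refine subset_trans (fun y hy => ?_) hsub
    rw [Metric.mem_ball, Real.dist_eq, abs_lt]
    constructor <;> linarith [hy.1, hy.2]
  · rintro _ ⟨a, b, rfl⟩
    -- The `min` makes the formula return `0` for the empty interval with `b < a`.
    have key : ∀ κ : ProbabilityMeasure ℝ, ((κ (Set.Ioc a b) : NNReal) : ℝ) =
        (κ : Measure ℝ).real (Set.Ioi (min a b)) - (κ : Measure ℝ).real (Set.Ioi b) := by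
      intro κ
      have h1 : Set.Ioc a b = Set.Ioi (min a b) \ Set.Ioi b := by
        rcases le_total a b with h | h
        · rw [min_eq_left h]; ext y; simp
        · rw [min_eq_right h]; simp [h]
      rw [← ProbabilityMeasure.measureReal_eq_coe_coeFn, h1,
        measureReal_sdiff (Set.Ioi_subset_Ioi (min_le_right _ _)) measurableSet_Ioi]
    rw [← NNReal.tendsto_coe]
    simp_rw [key]
    exact (h _).sub (h _)

/-- Weak convergence passes to finite products, and the half-space has its boundary in a hyperplane
that is null for the limit. -/
theorem tendsto_sumTail {μ : ℕ → ProbabilityMeasure ℝ} {ν : ProbabilityMeasure ℝ}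
    (h : Tendsto μ atTop (𝓝 ν)) (hν : ∀ x, x ≠ 1 → (ν : Measure ℝ) {x} = 0) (m : ℕ) {z : ℝ}
    (hz : ∀ j : ℕ, z ≠ j) :
    Tendsto (fun n => sumTail (μ n : Measure ℝ) m z) atTop (𝓝 (sumTail (ν : Measure ℝ) m z)) := by
  have h1 : Tendsto (fun n => ProbabilityMeasure.pi fun _ : Fin m => μ n) atTop
      (𝓝 (ProbabilityMeasure.pi fun _ : Fin m => ν)) :=
    (ProbabilityMeasure.continuous_pi.tendsto _).comp (tendsto_pi_nhds.2 fun _ => h)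
  refine ProbabilityMeasure.tendsto_measure_of_null_frontier_of_tendsto' h1
    (E := {t : Fin m → ℝ | z < ∑ j, t j}) ?_
  refine measure_mono_null (frontier_lt_subset_eq continuous_const (by fun_prop)) ?_
  simp_rw [eq_comm (a := z)]
  exact pi_sum_eq_null hν m hz

theorem continuousAt_measureReal_Ioi (κ : Measure ℝ) [IsProbabilityMeasure κ] {z : ℝ}
    (hz : κ {z} = 0) : ContinuousAt (fun x => κ.real (Set.Ioi x)) z := by
  have h1 : (fun x => κ.real (Set.Ioi x)) = fun x => 1 - cdf κ x := by
    funext x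
    rw [cdf_eq_real, ← Set.compl_Iic, probReal_compl_eq_one_sub measurableSet_Iic]
  rw [h1]
  refine continuousAt_const.sub ?_
  rw [(monotone_cdf κ).continuousAt_iff_leftLim_eq_rightLim, (cdf κ).rightLim_eq]
  have h2 := (cdf κ).measure_singleton z
  rw [measure_cdf, hz, eq_comm, ENNReal.ofReal_eq_zero] at h2
  exact le_antisymm ((monotone_cdf κ).leftLim_le le_rfl) (by linarith)

theorem continuousAt_sumTail {ν : Measure ℝ} [IsProbabilityMeasure ν]
    (hν : ∀ x, x ≠ 1 → ν {x} = 0) (m : ℕ) {z : ℝ} (hz : ∀ j : ℕ, z ≠ j) :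
    ContinuousAt (fun x => (sumTail ν m x).toReal) z := by
  have hmeas : Measurable fun t : Fin m → ℝ => ∑ j, t j := by fun_prop
  have := Measure.isProbabilityMeasure_map (μ := Measure.pi fun _ : Fin m => ν) hmeas.aemeasurable
  have h := continuousAt_measureReal_Ioi
    ((Measure.pi fun _ : Fin m => ν).map fun t => ∑ j, t j) (z := z) (by
      rw [Measure.map_apply hmeas (measurableSet_singleton z)]
      exact pi_sum_eq_null hν m hz)
  refine h.congr (Eventually.of_forall fun x => ?_)
  simp only [measureReal_def]
  rw [Measure.map_apply hmeas measurableSet_Ioi]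
  rfl

theorem sumTail_withDensity {d : ℝ → ℝ≥0∞} (hd : Measurable d)
    [SigmaFinite (volume.withDensity d)] (m : ℕ) (z : ℝ) :
    sumTail (volume.withDensity d) m z = ∫⁻ t in {t : Fin m → ℝ | z < ∑ j, t j}, ∏ j, d (t j) := by
  induction m generalizing z with
  | zero =>
    rw [sumTail_zero, volume_pi, Measure.pi_of_empty]
    split_ifs with h <;> simp [h]
  | succ m ih =>
    have hmp := volume_preserving_piFinSuccAbove (fun _ : Fin (m + 1) => ℝ) 0
    rw [sumTail_succ, lintegral_withDensity_eq_lintegral_mul _ hd (measurable_sumTail_sub _ m z),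
      ← lintegral_indicator (measurableSet_lt_sum _ _)]
    have hg : Measurable fun p : ℝ × (Fin m → ℝ) =>
        ({p : ℝ × (Fin m → ℝ) | z < p.1 + ∑ j, p.2 j}.indicator
          (fun p => d p.1 * ∏ j, d (p.2 j))) p := by
      refine Measurable.indicator (by fun_prop) ?_
      exact measurableSet_lt measurable_const (by fun_prop)
    have h1 := hmp.lintegral_comp hg
    rw [Measure.volume_eq_prod, lintegral_prod _ hg.aemeasurable] at h1
    calc _ = ∫⁻ s, ∫⁻ t : Fin m → ℝ, ({p : ℝ × (Fin m → ℝ) | z < p.1 + ∑ j, p.2 j}.indicator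
          (fun p => d p.1 * ∏ j, d (p.2 j))) (s, t) := by
          refine lintegral_congr fun s => ?_
          simp only [Pi.mul_apply]
          rw [ih, ← lintegral_const_mul _ (by fun_prop),
            ← lintegral_indicator (measurableSet_lt_sum _ _)]
          refine lintegral_congr fun t => ?_
          simp [Set.indicator_apply, sub_lt_iff_lt_add']
      _ = _ := by
          rw [← h1]
          refine lintegral_congr fun t => ?_
          simp [Fin.sum_univ_succ, Fin.prod_univ_succ, MeasurableEquiv.piFinSuccAbove,
            Fin.tail, Fin.insertNthEquiv, Set.indicator_apply]
          by_cases h : z < t 0 + ∑ j : Fin m, t j.succ <;> simp [h]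

/-! ### The Pareto limit law and the simplex integrals. -/

/-- The density `α s ^ (-α - 1)` on `(η, 1)`. -/
noncomputable def paretoDensity (α η : ℝ) : ℝ → ℝ≥0∞ :=
  (Set.Ioo η 1).indicator fun s => ENNReal.ofReal (α * s ^ (-α - 1))

theorem measurable_paretoDensity (α η : ℝ) : Measurable (paretoDensity α η) :=
  Measurable.indicator (by fun_prop) measurableSet_Ioo

/-- Only the trace of `A` on `(η, 1)` matters; this form covers both the total mass and the
half-lines. -/
theorem withDensity_paretoDensity_apply {α η a : ℝ} (hα : 0 < α) (ha : 0 < a) (ha1 : a ≤ 1)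
    {A : Set ℝ} (hA : MeasurableSet A) (hAI : A ∩ Set.Ioo η 1 = Set.Ioo a 1) :
    volume.withDensity (paretoDensity α η) A = ENNReal.ofReal (a ^ (-α) - 1) := by
  rw [withDensity_apply _ hA, paretoDensity, setLIntegral_indicator measurableSet_Ioo,
    Set.inter_comm, hAI]
  have h0 : (0 : ℝ) ∉ Set.uIcc a 1 := by
    rw [Set.uIcc_of_le ha1]
    exact fun h => absurd h.1 (not_le.2 ha)
  have hint : IntervalIntegrable (fun s : ℝ => α * s ^ (-α - 1)) volume a 1 :=
    (intervalIntegral.intervalIntegrable_rpow (Or.inr h0)).const_mul α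
  have h1 := (intervalIntegrable_iff_integrableOn_Ioo_of_le ha1).1 hint
  rw [← ofReal_integral_eq_lintegral_ofReal h1]
  · congr 1
    rw [← integral_Ioc_eq_integral_Ioo, ← intervalIntegral.integral_of_le ha1,
      intervalIntegral.integral_const_mul, integral_rpow (Or.inr ⟨by linarith, h0⟩)]
    rw [sub_add_cancel, Real.one_rpow]
    field_simp
    ring
  · filter_upwards [ae_restrict_mem measurableSet_Ioo] with s hs
    have : 0 < s := ha.trans hs.1
    simp only [Pi.zero_apply]
    positivity

theorem isFiniteMeasure_paretoDensity {α η : ℝ} (hα : 0 < α) (hη : 0 < η) (hη1 : η ≤ 1) :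
    IsFiniteMeasure (volume.withDensity (paretoDensity α η)) :=
  ⟨by
    rw [withDensity_paretoDensity_apply hα hη hη1 MeasurableSet.univ (Set.univ_inter _)]
    exact ENNReal.ofReal_lt_top⟩

/-- On `simplexD m z` the other `m - 1` coordinates sum to at most `m - 1`, so each coordinate
exceeds `η` and cutting the density there loses nothing. For `m = 0` the bound `z < 0` makes both
sides `1`. -/
theorem sumTail_paretoDensity {α η : ℝ} (hα : 0 < α) (hη : 0 < η) (hη1 : η ≤ 1) {m : ℕ} {z : ℝ}
    (hz : (m : ℝ) - 1 + η ≤ z) (hzm : z < m) :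
    (sumTail (volume.withDensity (paretoDensity α η)) m z).toReal = simplexW α m z := by
  have := isFiniteMeasure_paretoDensity hα hη hη1
  rcases Nat.eq_zero_or_pos m with rfl | hm
  · have : z < 0 := by simpa using hzm
    simp [sumTail_zero, simplexW, this]
  have hD : MeasurableSet (simplexD m z) := by
    have : simplexD m z = (⋂ j, {t : Fin m → ℝ | t j < 1}) ∩ {t | z < ∑ j, t j} := by
      ext t; simp [simplexD]
    rw [this]
    exact (MeasurableSet.iInter fun j => measurableSet_lt (by fun_prop) measurable_const).inter
      (measurableSet_lt_sum m z)
  have hDη : ∀ t ∈ simplexD m z, ∀ i, t i ∈ Set.Ioo η 1 := by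
    intro t ht i
    refine ⟨?_, ht.1 i⟩
    have h3 : ∑ j ∈ Finset.univ.erase i, t j ≤ (m - 1 : ℕ) := by
      refine (Finset.sum_le_card_nsmul _ _ 1 fun j _ => (ht.1 j).le).trans ?_
      simp [Finset.card_erase_of_mem]
    have h4 := Finset.add_sum_erase Finset.univ t (Finset.mem_univ i)
    have h5 := ht.2
    rw [Nat.cast_sub hm, Nat.cast_one] at h3
    linarith
  rw [sumTail_withDensity (measurable_paretoDensity α η), simplexW, if_neg hm.ne',
    ← integral_const_mul, integral_eq_lintegral_of_nonneg_ae]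
  · congr 1
    rw [← lintegral_indicator (measurableSet_lt_sum m z), ← lintegral_indicator hD]
    refine lintegral_congr fun t => ?_
    by_cases ht : t ∈ simplexD m z
    · have h1 : t ∈ {t : Fin m → ℝ | z < ∑ j, t j} := ht.2
      rw [Set.indicator_of_mem ht, Set.indicator_of_mem h1]
      have h2 : ∀ j, 0 ≤ t j := fun j => (hη.trans (hDη t ht j).1).le
      have h3 : ∀ j ∈ Finset.univ, 0 ≤ α * t j ^ (-α - 1) := fun j _ =>
        mul_nonneg hα.le (Real.rpow_nonneg (h2 j) _)
      rw [← Real.finsetProd_rpow _ _ fun j _ => h2 j]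
      calc ∏ j, paretoDensity α η (t j) = ∏ j, ENNReal.ofReal (α * t j ^ (-α - 1)) :=
            Finset.prod_congr rfl fun j _ => Set.indicator_of_mem (hDη t ht j) _
        _ = _ := by
            rw [← ENNReal.ofReal_prod_of_nonneg h3, Finset.prod_mul_distrib]
            simp
    · rw [Set.indicator_of_notMem ht, Set.indicator_apply]
      split_ifs with h
      · have : ∃ j, ¬ t j < 1 := by
          by_contra hc
          push Not at hc
          exact ht ⟨hc, h⟩
        obtain ⟨j, hj⟩ := this
        refine Finset.prod_eq_zero (Finset.mem_univ j) (Set.indicator_of_notMem ?_ _)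
        exact fun h => hj h.2
      · rfl
  · filter_upwards [ae_restrict_mem hD] with t ht
    have h2 : ∀ j, 0 ≤ t j := fun j => (hη.trans (hDη t ht j).1).le
    exact mul_nonneg (by positivity)
      (Real.rpow_nonneg (Finset.prod_nonneg fun j _ => h2 j) _)
  · exact Measurable.aestronglyMeasurable (by fun_prop)

/-- The limit `∑ C(m, j) W_{m-j}(z - j)`. -/
noncomputable def simplexSum (α : ℝ) (m : ℕ) (z : ℝ) : ℝ :=
  ∑ j ∈ Finset.range (m + 1), (m.choose j : ℝ) * simplexW α (m - j) (z - (j : ℝ))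

theorem sumTail_pareto_add_dirac {α η : ℝ} (hα : 0 < α) (hη : 0 < η) (hη1 : η ≤ 1) {m : ℕ} {z : ℝ}
    (hz : (m : ℝ) - 1 + η ≤ z) (hzm : z < m) :
    (sumTail (volume.withDensity (paretoDensity α η) + Measure.dirac 1) m z).toReal =
      simplexSum α m z := by
  have := isFiniteMeasure_paretoDensity hα hη hη1
  have hfin : ∀ i y, sumTail (volume.withDensity (paretoDensity α η)) i y ≠ ∞ :=
    fun i y => measure_ne_top _ _
  rw [sumTail_add_dirac, Finset.Nat.sum_antidiagonal_eq_sum_range_succ_mk, simplexSum,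
    ENNReal.toReal_sum fun j _ => ENNReal.mul_ne_top (ENNReal.natCast_ne_top _) (hfin _ _)]
  refine Finset.sum_congr rfl fun j hj => ?_
  have hjm : j ≤ m := Nat.lt_succ_iff.1 (Finset.mem_range.1 hj)
  rw [ENNReal.toReal_mul, ENNReal.toReal_natCast, sumTail_paretoDensity hα hη hη1]
  · rw [Nat.cast_sub hjm]; linarith
  · rw [Nat.cast_sub hjm]; linarith

/-- All terms are nonnegative and the term `j = m` equals `W_0 = 1`. This later turns absolute
errors into relative ones. -/
theorem one_le_simplexSum {α : ℝ} (hα : 0 < α) {m : ℕ} {z : ℝ} (hz : (m : ℝ) - 1 < z)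
    (hzm : z < m) : 1 ≤ simplexSum α m z := by
  have hη : 0 < z - (m - 1) := by linarith
  have hη1 : z - (m - 1) ≤ 1 := by linarith
  have h1 : ∀ j ∈ Finset.range (m + 1),
      0 ≤ (m.choose j : ℝ) * simplexW α (m - j) (z - (j : ℝ)) := by
    intro j hj
    have hjm : j ≤ m := Nat.lt_succ_iff.1 (Finset.mem_range.1 hj)
    rw [← sumTail_paretoDensity hα hη hη1]
    · positivity
    · rw [Nat.cast_sub hjm]; linarith
    · rw [Nat.cast_sub hjm]; linarith
  have h2 := Finset.single_le_sum h1 (Finset.self_mem_range_succ m)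
  simpa [simplexSum, simplexW] using h2

/-- The law of a Pareto variable started at `η` and censored at `1`. -/
noncomputable def censoredPareto (α η : ℝ) : Measure ℝ :=
  ENNReal.ofReal (η ^ α) • (volume.withDensity (paretoDensity α η) + Measure.dirac 1)

section censoredPareto
variable {α η : ℝ}

theorem censoredPareto_apply (hα : 0 < α) (hη : 0 < η) {a : ℝ} (ha : 0 < a) (ha1 : a ≤ 1)
    {A : Set ℝ} (hA : MeasurableSet A) (hAI : A ∩ Set.Ioo η 1 = Set.Ioo a 1) (h1 : (1 : ℝ) ∈ A) :
    censoredPareto α η A = ENNReal.ofReal (η ^ α * a ^ (-α)) := by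
  have h2 : 1 ≤ a ^ (-α) := Real.one_le_rpow_of_pos_of_le_one_of_nonpos ha ha1 (by linarith)
  have h3 : 0 ≤ η ^ α := by positivity
  rw [censoredPareto, Measure.smul_apply, Measure.add_apply,
    withDensity_paretoDensity_apply hα ha ha1 hA hAI, Measure.dirac_apply_of_mem h1, smul_eq_mul,
    ← ENNReal.ofReal_one, ← ENNReal.ofReal_add (by linarith) zero_le_one, sub_add_cancel,
    ← ENNReal.ofReal_mul h3]

theorem isProbabilityMeasure_censoredPareto (hα : 0 < α) (hη : 0 < η) (hη1 : η ≤ 1) :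
    IsProbabilityMeasure (censoredPareto α η) :=
  ⟨by
    rw [censoredPareto_apply hα hη hη hη1 MeasurableSet.univ (Set.univ_inter _) (Set.mem_univ _),
      ← Real.rpow_add hη]
    simp⟩

theorem censoredPareto_singleton {x : ℝ} (hx : x ≠ 1) :
    censoredPareto α η {x} = 0 := by
  have h1 : volume.withDensity (paretoDensity α η) {x} = 0 :=
    withDensity_absolutelyContinuous _ _ (by simp)
  simp [censoredPareto, h1, hx.symm]

theorem sumTail_censoredPareto (hα : 0 < α) (hη : 0 < η) (hη1 : η ≤ 1) {m : ℕ}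
    {z : ℝ} (hz : (m : ℝ) - 1 + η ≤ z) (hzm : z < m) :
    (sumTail (censoredPareto α η) m z).toReal = (η ^ α) ^ m * simplexSum α m z := by
  have := isFiniteMeasure_paretoDensity hα hη hη1
  rw [censoredPareto, sumTail_smul _ ENNReal.ofReal_ne_top, ENNReal.toReal_mul, ENNReal.toReal_pow,
    ENNReal.toReal_ofReal (by positivity), sumTail_pareto_add_dirac hα hη hη1 hz hzm]

end censoredPareto

theorem ne_natCast_of_mem_Ioo {m : ℕ} {z : ℝ} (hz : z ∈ Set.Ioo ((m : ℝ) - 1) m) (j : ℕ) :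
    z ≠ j := by
  rintro rfl
  have h1 : j < m := by exact_mod_cast hz.2
  have h2 : (m : ℝ) < j + 1 := by linarith [hz.1]
  have h3 : m < j + 1 := by exact_mod_cast h2
  omega

/-- Near `z`, for `η < z - (m - 1)`, the sum is a constant multiple of a half-space mass of
`censoredPareto α η`. Its only atom is at `1`, so sums of coordinates have no atom off the integers.
-/
theorem continuousOn_simplexSum {α : ℝ} (hα : 0 < α) (m : ℕ) :
    ContinuousOn (simplexSum α m) (Set.Ioo ((m : ℝ) - 1) m) := by
  intro z hz
  obtain ⟨η, hη, hηz⟩ := exists_between (sub_pos.2 hz.1)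
  have hη1 : η ≤ 1 := by linarith [hz.2]
  have := isProbabilityMeasure_censoredPareto hα hη hη1
  have h1 := continuousAt_sumTail (fun x hx => censoredPareto_singleton (α := α) (η := η) hx) m
    (ne_natCast_of_mem_Ioo hz)
  have h2 := h1.const_mul ((η ^ α) ^ m)⁻¹
  refine (h2.congr ?_).continuousWithinAt
  filter_upwards [Ioo_mem_nhds (show (m : ℝ) - 1 + η < z by linarith) hz.2] with x hx
  rw [sumTail_censoredPareto hα hη hη1 hx.1.le hx.2, inv_mul_cancel_left₀ (by positivity)]

/-! ### Convergence of the normalized half-space masses. -/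

/-- Sums of `m` i.i.d. variables bounded by `1` with asymptotically Pareto tails. -/
theorem tendsto_sumTail_div_pow {α : ℝ} (hα : 0 < α) {ν : ℕ → Measure ℝ}
    (hprob : ∀ n, IsProbabilityMeasure (ν n)) (hν : ∀ n, ν n (Set.Ioi 1) = 0) {v : ℕ → ℝ}
    (hv : ∀ᶠ n in atTop, 0 < v n)
    (hlim : ∀ t ∈ Set.Ioo (0 : ℝ) 1,
      Tendsto (fun n => (ν n).real (Set.Ioi t) / v n) atTop (𝓝 (t ^ (-α)))) {m : ℕ} {z : ℝ}
    (hz : z ∈ Set.Ioo ((m : ℝ) - 1) m) :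
    Tendsto (fun n => (sumTail (ν n) m z).toReal / v n ^ m) atTop (𝓝 (simplexSum α m z)) := by
  classical
  -- Since `η < z - (m - 1)`, a sum above `z` forces every coordinate above `η`. Conditioning on
  -- exceeding `η` thus loses nothing, and it avoids the infinite mass of the limit near `0`.
  obtain ⟨η, hη, hηz⟩ := exists_between (sub_pos.2 hz.1)
  have hη1 : η < 1 := by linarith [hz.2]
  have hP := isProbabilityMeasure_censoredPareto hα hη hη1.le
  have hlη := hlim η ⟨hη, hη1⟩
  have hηα : 0 < η ^ (-α) := Real.rpow_pos_of_pos hη _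
  have hpos : ∀ᶠ n in atTop, 0 < v n ∧ 0 < (ν n).real (Set.Ioi η) := by
    filter_upwards [hlη.eventually (lt_mem_nhds hηα), hv] with n h1 h2
    exact ⟨h2, (div_pos_iff_of_pos_right h2).1 h1⟩
  let μ : ℕ → ProbabilityMeasure ℝ := fun n =>
    if h : ν n (Set.Ioi η) ≠ 0 then
      ⟨(ν n)[|Set.Ioi η], @cond_isProbabilityMeasure _ _ (ν n) _ _ h⟩
    else ⟨censoredPareto α η, hP⟩
  have hμ : ∀ᶠ n in atTop, (μ n : Measure ℝ) = (ν n)[|Set.Ioi η] := by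
    filter_upwards [hpos] with n hn
    have h : ν n (Set.Ioi η) ≠ 0 := fun h0 => by simp [measureReal_def, h0] at hn
    simp [μ, h]
  have hconv : Tendsto μ atTop (𝓝 ⟨censoredPareto α η, hP⟩) := by
    refine tendsto_probabilityMeasure_of_tendsto_Ioi fun t => ?_
    have hreal : ∀ᶠ n in atTop, (μ n : Measure ℝ).real (Set.Ioi t) =
        (ν n).real (Set.Ioi (max η t)) / v n / ((ν n).real (Set.Ioi η) / v n) := by
      filter_upwards [hμ, hpos] with n h1 h2
      have := hprob n
      rw [h1, measureReal_def, cond_apply measurableSet_Ioi, Set.Ioi_inter_Ioi, ENNReal.toReal_mul,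
        ENNReal.toReal_inv, ← measureReal_def, ← measureReal_def,
        div_div_div_cancel_right₀ h2.1.ne', div_eq_inv_mul]
    refine Tendsto.congr' (EventuallyEq.symm hreal) ?_
    simp only [ProbabilityMeasure.coe_mk]
    rcases lt_or_ge t 1 with ht | ht
    · have hmax : max η t ∈ Set.Ioo (0 : ℝ) 1 := ⟨hη.trans_le (le_max_left _ _), max_lt hη1 ht⟩
      have hval : (censoredPareto α η).real (Set.Ioi t) = max η t ^ (-α) / η ^ (-α) := by
        rw [measureReal_def, censoredPareto_apply hα hη hmax.1 hmax.2.le measurableSet_Ioi (by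
          ext s; simp only [Set.mem_inter_iff, Set.mem_Ioi, Set.mem_Ioo, max_lt_iff]; tauto) ht,
          ENNReal.toReal_ofReal (by have := hmax.1; positivity), Real.rpow_neg hη.le, div_inv_eq_mul,
          mul_comm]
      rw [hval]
      exact (hlim _ hmax).div hlη hηα.ne'
    · have hval : (censoredPareto α η).real (Set.Ioi t) = 0 := by
        have h1 : volume.withDensity (paretoDensity α η) (Set.Ioi t) = 0 := by
          have : Set.Ioo η 1 ∩ Set.Ioi t = ∅ := by
            ext s
            simp only [Set.mem_inter_iff, Set.mem_Ioi, Set.mem_Ioo, Set.mem_empty_iff_false, iff_false]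
            rintro ⟨⟨-, h⟩, h'⟩
            linarith
          rw [withDensity_apply _ measurableSet_Ioi, paretoDensity,
            setLIntegral_indicator measurableSet_Ioo, this]
          simp
        have h2 : Measure.dirac (1 : ℝ) (Set.Ioi t) = 0 := by
          rw [Measure.dirac_apply' _ measurableSet_Ioi]
          simp [ht]
        simp [measureReal_def, censoredPareto, h1, h2]
      have hzero : ∀ n, (ν n).real (Set.Ioi (max η t)) = 0 := fun n => by
        rw [measureReal_def, measure_mono_null (Set.Ioi_subset_Ioi (ht.trans (le_max_right _ _)))
          (hν n), ENNReal.toReal_zero]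
      simp [hval, hzero]
  have hT := tendsto_sumTail hconv (fun x hx => censoredPareto_singleton (α := α) (η := η) hx) m
    (ne_natCast_of_mem_Ioo hz)
  have hT' := (ENNReal.tendsto_toReal (measure_ne_top (Measure.pi fun _ : Fin m => censoredPareto α η) _)).comp hT
  -- Undoing the conditioning multiplies by the `m`-th power of a ratio tending to `η ^ (-α)`, which
  -- cancels the factor `(η ^ α) ^ m` of the conditioned limit.
  have hfin : Tendsto _ atTop (𝓝 ((sumTail (censoredPareto α η) m z).toReal * (η ^ (-α)) ^ m)) :=
    hT'.mul (hlη.pow m)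
  rw [sumTail_censoredPareto hα hη hη1.le (by linarith) hz.2, mul_right_comm, ← mul_pow,
    ← Real.rpow_add hη, add_neg_cancel, Real.rpow_zero, one_pow, one_mul] at hfin
  refine hfin.congr' ?_
  filter_upwards [hμ, hpos] with n h1 h2
  have := hprob n
  have h0 : ν n (Set.Ioi η) ≠ 0 := fun h0 => by simp [measureReal_def, h0] at h2
  have h3 : (ν n)[|Set.Ioi η] = (ν n (Set.Ioi η))⁻¹ • (ν n).restrict (Set.Ioi η) := rfl
  simp only [Function.comp]
  rw [h1, h3, sumTail_smul _ (ENNReal.inv_ne_top.2 h0), sumTail_restrict _ (hν n) (by linarith),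
    ENNReal.toReal_mul, ENNReal.toReal_pow, ENNReal.toReal_inv, ← measureReal_def]
  have h4 := h2.2.ne'
  have h5 := h2.1.ne'
  rw [inv_pow, div_pow]
  field_simp

/-! ### Exponential moments of truncated variables. -/

theorem exp_le_one_add_add_sq {u : ℝ} (hu : u ≤ 1) : Real.exp u ≤ 1 + u + u ^ 2 := by
  rcases le_or_gt (-1) u with h | h
  · have := (abs_le.1 (Real.abs_exp_sub_one_sub_id_le (abs_le.2 ⟨h, hu⟩))).2
    linarith
  · have := Real.exp_le_one_iff.2 (show u ≤ 0 by linarith)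
    nlinarith

section RightTail
variable {Ω : Type*} [MeasurableSpace Ω] {P : Measure Ω}

theorem antitone_rightTail [IsFiniteMeasure P] (X : Ω → ℝ) : Antitone (rightTail P X) :=
  fun _ _ h => measureReal_mono fun _ hω => h.trans_lt hω

/-- The exponential is bounded quadratically where `l * min X y ≤ 1` and by `exp (l * y)` elsewhere,
where necessarily `X > 1 / l`. Truncation from above makes the mean nonpositive and, as `0 ≤ y`,
does not increase the second moment. -/
theorem mgf_min_le [IsProbabilityMeasure P] {X : Ω → ℝ} (hmeas : Measurable X) (hL2 : MemLp X 2 P)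
    (hmean : ∫ ω, X ω ∂P = 0) (hvar : ∫ ω, X ω ^ 2 ∂P = 1) {y l : ℝ} (hy : 0 ≤ y) (hl : 0 < l) :
    Integrable (fun ω => Real.exp (l * min (X ω) y)) P ∧
    mgf (fun ω => min (X ω) y) P l ≤ Real.exp (l ^ 2 + Real.exp (l * y) * rightTail P X (1 / l)) := by
  have hX : Integrable X P := hL2.integrable (by norm_num)
  have hX2 : Integrable (fun ω => X ω ^ 2) P := hL2.integrable_sq
  have hmin : Measurable fun ω => min (X ω) y := hmeas.min measurable_const
  have hsq : ∀ ω, min (X ω) y ^ 2 ≤ X ω ^ 2 := fun ω => by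
    rcases le_total (X ω) y with h | h
    · rw [min_eq_left h]
    · rw [min_eq_right h]; gcongr
  have hYint : Integrable (fun ω => min (X ω) y) P := hX.inf (integrable_const y)
  have hY2 : Integrable (fun ω => min (X ω) y ^ 2) P :=
    hX2.mono' (hmin.pow_const 2).aestronglyMeasurable (Eventually.of_forall fun ω => by
      rw [Real.norm_eq_abs, abs_of_nonneg (sq_nonneg _)]; exact hsq ω)
  have hS : MeasurableSet {ω | 1 / l < X ω} := measurableSet_lt measurable_const hmeas
  have hind : Integrable ({ω | 1 / l < X ω}.indicator fun _ => Real.exp (l * y)) P :=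
    (integrable_const _).indicator hS
  have hexp : Integrable (fun ω => Real.exp (l * min (X ω) y)) P := by
    refine (integrable_const (Real.exp (l * y))).mono' (by fun_prop)
      (Eventually.of_forall fun ω => ?_)
    rw [Real.norm_eq_abs, abs_of_pos (Real.exp_pos _)]
    gcongr
    exact min_le_right _ _
  refine ⟨hexp, ?_⟩
  have hpt : ∀ ω, Real.exp (l * min (X ω) y) ≤ 1 + l * min (X ω) y + l ^ 2 * min (X ω) y ^ 2 +
      {ω | 1 / l < X ω}.indicator (fun _ => Real.exp (l * y)) ω := by
    intro ω
    by_cases h : l * min (X ω) y ≤ 1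
    · have h1 := exp_le_one_add_add_sq h
      have h2 : 0 ≤ {ω | 1 / l < X ω}.indicator (fun _ => Real.exp (l * y)) ω :=
        Set.indicator_nonneg (fun _ _ => (Real.exp_pos _).le) ω
      rw [mul_pow] at h1
      linarith
    · push Not at h
      have h1 : ω ∈ {ω | 1 / l < X ω} := by
        have h3 : l * min (X ω) y ≤ l * X ω := by gcongr; exact min_le_left _ _
        show 1 / l < X ω
        rw [div_lt_iff₀' hl]
        linarith
      rw [Set.indicator_of_mem h1]
      have h2 : Real.exp (l * min (X ω) y) ≤ Real.exp (l * y) := by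
        gcongr; exact min_le_right _ _
      have h3 : 0 ≤ l ^ 2 * min (X ω) y ^ 2 := by positivity
      linarith
  have hm : ∫ ω, min (X ω) y ∂P ≤ 0 := by
    rw [← hmean]
    exact integral_mono hYint hX fun ω => min_le_left _ _
  have hv : ∫ ω, min (X ω) y ^ 2 ∂P ≤ 1 := by
    rw [← hvar]
    exact integral_mono hY2 hX2 hsq
  have hA1 : Integrable (fun ω => 1 + l * min (X ω) y) P :=
    (integrable_const 1).add (hYint.const_mul l)
  have hA2 : Integrable (fun ω => 1 + l * min (X ω) y + l ^ 2 * min (X ω) y ^ 2) P :=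
    hA1.add (hY2.const_mul (l ^ 2))
  have hI := integral_mono hexp (hA2.add hind) hpt
  have hval : ∫ ω, (1 + l * min (X ω) y + l ^ 2 * min (X ω) y ^ 2 +
      {ω | 1 / l < X ω}.indicator (fun _ => Real.exp (l * y)) ω) ∂P =
      1 + l * ∫ ω, min (X ω) y ∂P + l ^ 2 * ∫ ω, min (X ω) y ^ 2 ∂P +
        Real.exp (l * y) * rightTail P X (1 / l) := by
    rw [integral_add hA2 hind, integral_add hA1 (hY2.const_mul (l ^ 2)),
      integral_add (integrable_const 1) (hYint.const_mul l), integral_const_mul, integral_const_mul,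
      integral_indicator_const _ hS, rightTail, smul_eq_mul, mul_comm (Real.exp _)]
    simp
  have h1 : l * ∫ ω, min (X ω) y ∂P ≤ 0 := mul_nonpos_of_nonneg_of_nonpos hl.le hm
  have h2 : l ^ 2 * ∫ ω, min (X ω) y ^ 2 ∂P ≤ l ^ 2 := mul_le_of_le_one_right (sq_nonneg l) hv
  have h3 := Real.add_one_le_exp (l ^ 2 + Real.exp (l * y) * rightTail P X (1 / l))
  have h4 : mgf (fun ω => min (X ω) y) P l ≤ _ := hI.trans_eq hval
  linarith

end RightTail

/-! ### Independence and tail bounds for i.i.d. sums. -/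

section IID
variable {Ω : Type*} [MeasurableSpace Ω] {P : Measure Ω} {ξ : ℕ → Ω → ℝ}

theorem rightTail_eq (hident : ∀ j, IdentDistrib (ξ j) (ξ 0) P P) (j : ℕ) (t : ℝ) :
    rightTail P (ξ j) t = rightTail P (ξ 0) t := by
  have h := (hident j).measure_mem_eq (measurableSet_Ioi (a := t))
  simp only [rightTail, measureReal_def]
  exact congrArg ENNReal.toReal h

theorem measureReal_inter_blocks (hmeas : ∀ j, Measurable (ξ j)) (hindep : iIndepFun ξ P)
    {I J : Finset ℕ} (hIJ : Disjoint I J) {A : Set (I → ℝ)} {B : Set (J → ℝ)}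
    (hA : MeasurableSet A) (hB : MeasurableSet B) :
    P.real ({ω | (fun i : I => ξ i ω) ∈ A} ∩ {ω | (fun j : J => ξ j ω) ∈ B}) =
      P.real {ω | (fun i : I => ξ i ω) ∈ A} * P.real {ω | (fun j : J => ξ j ω) ∈ B} := by
  have h := (hindep.indepFun_finset I J hIJ hmeas).measure_inter_preimage_eq_mul A B hA hB
  simp only [measureReal_def, ← ENNReal.toReal_mul]
  exact congrArg ENNReal.toReal h

theorem measureReal_forall_lt (hindep : iIndepFun ξ P)
    (hident : ∀ j, IdentDistrib (ξ j) (ξ 0) P P) (a : ℝ) (I : Finset ℕ) :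
    P.real {ω | ∀ i ∈ I, a < ξ i ω} = rightTail P (ξ 0) a ^ I.card := by
  have h := hindep.measure_inter_preimage_eq_mul I (sets := fun _ => Set.Ioi a)
    fun _ _ => measurableSet_Ioi
  have hset : {ω | ∀ i ∈ I, a < ξ i ω} = ⋂ i ∈ I, ξ i ⁻¹' Set.Ioi a := by
    ext ω; simp
  rw [hset, measureReal_def, h, ENNReal.toReal_prod, ← Finset.prod_const]
  exact Finset.prod_congr rfl fun i _ => rightTail_eq hident i a

variable [IsProbabilityMeasure P]

/-- Chernoff bound for sums of variables truncated from above. -/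
theorem measureReal_lt_sum_min_le (hmeas : ∀ j, Measurable (ξ j)) (hindep : iIndepFun ξ P)
    (hident : ∀ j, IdentDistrib (ξ j) (ξ 0) P P) (hL2 : MemLp (ξ 0) 2 P)
    (hmean : ∫ ω, ξ 0 ω ∂P = 0) (hvar : ∫ ω, (ξ 0 ω) ^ 2 ∂P = 1) {y l : ℝ} (hy : 0 ≤ y)
    (hl : 0 < l) (a : ℝ) (J : Finset ℕ) :
    P.real {ω | a < ∑ j ∈ J, min (ξ j ω) y} ≤
      Real.exp (-l * a) *
        Real.exp (J.card * (l ^ 2 + Real.exp (l * y) * rightTail P (ξ 0) (1 / l))) := by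
  have hmin : ∀ j, Measurable fun ω => min (ξ j ω) y := fun j => (hmeas j).min measurable_const
  have hind : iIndepFun (fun j ω => min (ξ j ω) y) P :=
    hindep.comp (fun _ s => min s y) fun _ => measurable_id.min measurable_const
  have hid : ∀ j, IdentDistrib (fun ω => min (ξ j ω) y) (fun ω => min (ξ 0 ω) y) P P := fun j =>
    (hident j).comp (measurable_id.min measurable_const)
  obtain ⟨hi0, hm0⟩ := mgf_min_le (hmeas 0) hL2 hmean hvar hy hl
  have hsum : (fun ω => ∑ j ∈ J, min (ξ j ω) y) = ∑ j ∈ J, fun ω => min (ξ j ω) y := by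
    funext ω; simp
  have hint : Integrable (fun ω => Real.exp (l * ∑ j ∈ J, min (ξ j ω) y)) P := by
    have h1 : Measurable fun ω => ∑ j ∈ J, min (ξ j ω) y :=
      Finset.measurable_fun_sum _ fun j _ => hmin j
    refine (integrable_const (Real.exp (l * (J.card * y)))).mono' (by fun_prop)
      (Eventually.of_forall fun ω => ?_)
    rw [Real.norm_eq_abs, abs_of_pos (Real.exp_pos _)]
    gcongr
    rw [← nsmul_eq_mul]
    exact Finset.sum_le_card_nsmul _ _ _ fun j _ => min_le_right _ _
  have h := measure_ge_le_exp_mul_mgf (μ := P) (X := fun ω => ∑ j ∈ J, min (ξ j ω) y) a hl.le hint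
  refine (measureReal_mono fun ω (hω : a < _) => hω.le).trans (h.trans ?_)
  gcongr
  rw [hsum, hind.mgf_sum hmin, Real.exp_nat_mul, ← Finset.prod_const]
  refine Finset.prod_le_prod (fun j _ => mgf_nonneg) fun j _ => ?_
  refine le_trans (le_of_eq ?_) hm0
  rw [← mgf_id_map (hmin j).aemeasurable, ← mgf_id_map (hmin 0).aemeasurable, (hid j).map_eq]

/-- Chebyshev's inequality: the variance of the sum is the number of terms. -/
theorem measureReal_sum_le_neg_le (hindep : iIndepFun ξ P)
    (hident : ∀ j, IdentDistrib (ξ j) (ξ 0) P P) (hL2 : MemLp (ξ 0) 2 P)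
    (hmean : ∫ ω, ξ 0 ω ∂P = 0) (hvar : ∫ ω, (ξ 0 ω) ^ 2 ∂P = 1) {a : ℝ} (ha : 0 < a)
    (J : Finset ℕ) : P.real {ω | ∑ j ∈ J, ξ j ω ≤ -a} ≤ J.card / a ^ 2 := by
  have hL : ∀ j, MemLp (ξ j) 2 P := fun j => (hident j).memLp_iff.2 hL2
  have hE : ∀ j, ∫ ω, ξ j ω ∂P = 0 := fun j => (hident j).integral_eq.trans hmean
  have hV : ∀ j, Var[ξ j; P] = 1 := fun j => by
    rw [(hident j).variance_eq, variance_of_integral_eq_zero hL2.aestronglyMeasurable.aemeasurable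
      hmean, hvar]
  have hsum : MemLp (∑ j ∈ J, ξ j) 2 P := memLp_finsetSum' _ fun j _ => hL j
  have h := meas_ge_le_variance_div_sq hsum ha
  rw [IndepFun.variance_sum (fun j _ => hL j) (fun i _ j _ hij => hindep.indepFun hij),
    Finset.sum_congr rfl fun j _ => hV j] at h
  have hE' : ∫ ω, (∑ j ∈ J, ξ j) ω ∂P = 0 := by
    simp only [Finset.sum_apply]
    rw [integral_finsetSum _ fun j _ => (hL j).integrable (by norm_num)]
    simp [hE]
  rw [hE'] at h
  simp only [Finset.sum_const, nsmul_eq_mul, mul_one, Finset.sum_apply, sub_zero] at h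
  have h2 := ENNReal.toReal_le_of_le_ofReal (by positivity) h
  refine le_trans (measureReal_mono fun ω (hω : _ ≤ -a) => ?_) h2
  show a ≤ |_|
  rw [le_abs]
  right
  linarith

/-- Sums of `min (ξ i) M` over `k` indices have the same law as a `k`-fold product. -/
theorem measureReal_lt_sum_min_eq (hmeas : ∀ j, Measurable (ξ j)) (hindep : iIndepFun ξ P)
    (hident : ∀ j, IdentDistrib (ξ j) (ξ 0) P P) {M : ℝ} (hM : 0 < M) (z : ℝ) (I : Finset ℕ) :
    P.real {ω | z * M < ∑ i ∈ I, min (ξ i ω) M} =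
      (sumTail (P.map fun ω => min (ξ 0 ω / M) 1) I.card z).toReal := by
  let e := I.orderEmbOfFin rfl
  have hφ : Measurable fun s : ℝ => min (s / M) 1 := (measurable_id.div_const M).min measurable_const
  have h1 : iIndepFun (fun (i : Fin I.card) ω => min (ξ (e i) ω / M) 1) P :=
    (hindep.precomp e.injective).comp (fun _ s => min (s / M) 1) fun _ => hφ
  have h2 : ∀ i : Fin I.card, AEMeasurable (fun ω => min (ξ (e i) ω / M) 1) P := fun i =>
    (hφ.comp (hmeas (e i))).aemeasurable
  have h3 := (iIndepFun_iff_map_fun_eq_pi_map h2).1 h1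
  have h4 : ∀ i : Fin I.card, P.map (fun ω => min (ξ (e i) ω / M) 1) =
      P.map fun ω => min (ξ 0 ω / M) 1 := fun i => ((hident (e i)).comp hφ).map_eq
  simp_rw [h4] at h3
  have hvec : Measurable fun ω (i : Fin I.card) => min (ξ (e i) ω / M) 1 :=
    measurable_pi_lambda _ fun i => hφ.comp (hmeas (e i))
  rw [sumTail, ← h3, Measure.map_apply hvec
    (measurableSet_lt_sum _ _), measureReal_def]
  congr 2
  ext ω
  have h5 : ∑ i ∈ I, min (ξ i ω) M = (∑ j, min (ξ (e j) ω / M) 1) * M := by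
    rw [Finset.sum_mul]
    have h6 : Finset.univ.map e.toEmbedding = I := by
      ext x
      simp only [Finset.mem_map, Finset.mem_univ, true_and]
      have := Finset.range_orderEmbOfFin I rfl
      rw [Set.ext_iff] at this
      exact this x
    conv_lhs => rw [← h6]
    rw [Finset.sum_map]
    refine Finset.sum_congr rfl fun j _ => ?_
    rw [min_mul_of_nonneg _ _ hM.le, div_mul_cancel₀ _ hM.ne', one_mul]
    rfl
  simp only [Set.mem_preimage, Set.mem_ofPred_eq]
  rw [h5, mul_lt_mul_iff_left₀ hM]

theorem card_mul_lt_of_lt_sum_min {k : ℕ} {M : ℝ} {I : Finset ℕ} (hI : I.card = k)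
    {f : ℕ → ℝ} {z : ℝ} (h : z * M < ∑ i ∈ I, min (f i) M) {i : ℕ} (hi : i ∈ I) :
    (z - (k - 1)) * M < f i := by
  have h1 : ∑ j ∈ I.erase i, min (f j) M ≤ (I.card - 1 : ℕ) * M := by
    rw [← Finset.card_erase_of_mem hi, ← nsmul_eq_mul]
    exact Finset.sum_le_card_nsmul _ _ _ fun j _ => min_le_right _ _
  have h2 := Finset.add_sum_erase I (fun j => min (f j) M) hi
  have h3 : 1 ≤ I.card := Finset.card_pos.2 ⟨i, hi⟩
  rw [Nat.cast_sub h3, Nat.cast_one, hI] at h1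
  have h4 := min_le_left (f i) M
  linarith

/-! ### Two-sided bounds by the number of large summands. -/

/-- Upper bound: `k` large summands, up to more or fewer large ones or an atypical remainder. -/
theorem measureReal_lt_censoredSum_le (hmeas : ∀ j, Measurable (ξ j)) (hindep : iIndepFun ξ P)
    (hident : ∀ j, IdentDistrib (ξ j) (ξ 0) P P) {M δ ε z τ : ℝ} {k n : ℕ} (hM : 0 < M)
    (hδ : 0 ≤ δ) (hδ1 : δ ≤ 1) (hk : 1 ≤ k) (hεz : ε ≤ z - (k - 1))
    (hτ : ∀ J ⊆ Finset.range n, P.real {ω | ε * M < ∑ j ∈ J, min (ξ j ω) (δ * M)} ≤ τ) :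
    P.real {ω | z * M < censoredSum ξ M n ω} ≤
      n.choose k * (sumTail (P.map fun ω => min (ξ 0 ω / M) 1) k (z - ε)).toReal +
      (n * rightTail P (ξ 0) (δ * M)) ^ (k + 1) + τ + (n * rightTail P (ξ 0) (δ * M)) ^ k * τ := by
  classical
  set V := rightTail P (ξ 0) (δ * M) with hV
  have hV0 : 0 ≤ V := measureReal_nonneg
  have hτ0 : 0 ≤ τ := measureReal_nonneg.trans (hτ ∅ (Finset.empty_subset _))
  let R := Finset.range n
  let A : Finset ℕ → Set Ω := fun I => {ω | (z - ε) * M < ∑ i ∈ I, min (ξ i ω) M}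
  let B : Finset ℕ → Set Ω := fun I => {ω | ∀ i ∈ I, δ * M < ξ i ω}
  let C : Finset ℕ → Set Ω := fun J => {ω | ε * M < ∑ j ∈ J, min (ξ j ω) (δ * M)}
  -- The split is by the number of summands above `δ * M`: fewer than `k` leads to `C R`, more than
  -- `k` to some `B I`, and exactly `k` to `A I` or to an atypical remainder `C (R \ I)`.
  have hcover : {ω | z * M < censoredSum ξ M n ω} ⊆
      (⋃ I ∈ R.powersetCard k, A I) ∪ (⋃ I ∈ R.powersetCard (k + 1), B I) ∪ C R ∪
        ⋃ I ∈ R.powersetCard k, B I ∩ C (R \ I) := by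
    intro ω (hω : z * M < ∑ j ∈ R, min (ξ j ω) M)
    simp only [Set.mem_union, Set.mem_iUnion, Finset.mem_powersetCard, exists_prop]
    let N := R.filter fun j => δ * M < ξ j ω
    have hNR : N ⊆ R := Finset.filter_subset _ _
    have hsmall : ∀ j ∈ R \ N, ξ j ω ≤ δ * M := by
      intro j hj
      rw [Finset.mem_sdiff, Finset.mem_filter] at hj
      by_contra hc
      exact hj.2 ⟨hj.1, not_le.1 hc⟩
    have hδM : δ * M ≤ M := mul_le_of_le_one_left hM.le hδ1
    have hdec : ∑ j ∈ R, min (ξ j ω) M =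
        ∑ j ∈ R \ N, min (ξ j ω) (δ * M) + ∑ j ∈ N, min (ξ j ω) M := by
      rw [← Finset.sum_sdiff hNR]
      congr 1
      refine Finset.sum_congr rfl fun j hj => ?_
      rw [min_eq_left (hsmall j hj), min_eq_left ((hsmall j hj).trans hδM)]
    rcases lt_trichotomy N.card k with h | h | h
    · left; right
      have h1 : ∑ j ∈ N, min (ξ j ω) M ≤ (k - 1 : ℕ) * M := by
        refine (Finset.sum_le_card_nsmul _ _ M fun j _ => min_le_right _ _).trans ?_
        rw [nsmul_eq_mul]
        have : N.card ≤ k - 1 := by omega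
        gcongr
      -- Adding back the large indices, truncated at `δ * M`, only increases the sum. One event over
      -- all of `R` therefore serves every `N`, with no union over index sets.
      have h2 : 0 ≤ ∑ j ∈ N, min (ξ j ω) (δ * M) := Finset.sum_nonneg fun j hj => by
        have h3 : δ * M < ξ j ω := (Finset.mem_filter.1 hj).2
        rw [min_eq_right h3.le]
        positivity
      have h3 := Finset.sum_sdiff (f := fun j => min (ξ j ω) (δ * M)) hNR
      rw [Nat.cast_sub hk, Nat.cast_one] at h1
      show ε * M < ∑ j ∈ R, min (ξ j ω) (δ * M)
      have h4 : ε * M ≤ (z - (k - 1)) * M := by gcongr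
      linarith
    · by_cases hc : ε * M < ∑ j ∈ R \ N, min (ξ j ω) (δ * M)
      · right
        exact ⟨N, ⟨hNR, h⟩, fun i hi => (Finset.mem_filter.1 hi).2, hc⟩
      · left; left; left
        refine ⟨N, ⟨hNR, h⟩, ?_⟩
        show (z - ε) * M < ∑ j ∈ N, min (ξ j ω) M
        linarith
    · left; left; right
      obtain ⟨I, hIN, hI⟩ := Finset.exists_subset_card_eq (Nat.succ_le_of_lt h)
      exact ⟨I, ⟨hIN.trans hNR, hI⟩, fun i hi => (Finset.mem_filter.1 (hIN hi)).2⟩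
  have hA : P.real (⋃ I ∈ R.powersetCard k, A I) ≤
      n.choose k * (sumTail (P.map fun ω => min (ξ 0 ω / M) 1) k (z - ε)).toReal := by
    refine (measureReal_biUnion_finset_le _ _).trans (le_of_eq ?_)
    rw [Finset.sum_congr rfl fun I hI => by
      rw [measureReal_lt_sum_min_eq hmeas hindep hident hM, (Finset.mem_powersetCard.1 hI).2]]
    simp [R]
  have hpow : ∀ m : ℕ, (n.choose m : ℝ) ≤ (n : ℝ) ^ m := fun m => by
    exact_mod_cast Nat.choose_le_pow n m
  have hB : P.real (⋃ I ∈ R.powersetCard (k + 1), B I) ≤ (n * V) ^ (k + 1) := by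
    refine (measureReal_biUnion_finset_le _ _).trans ?_
    rw [Finset.sum_congr rfl fun I hI => by
      rw [measureReal_forall_lt hindep hident, (Finset.mem_powersetCard.1 hI).2]]
    rw [Finset.sum_const, Finset.card_powersetCard, Finset.card_range, nsmul_eq_mul, mul_pow]
    gcongr
    exact hpow _
  have hC : P.real (⋃ I ∈ R.powersetCard k, B I ∩ C (R \ I)) ≤ (n * V) ^ k * τ := by
    refine (measureReal_biUnion_finset_le _ _).trans ?_
    have h1 : ∀ I ∈ R.powersetCard k, P.real (B I ∩ C (R \ I)) ≤ V ^ k * τ := by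
      intro I hI
      rw [Finset.mem_powersetCard] at hI
      have hBm : MeasurableSet {x : I → ℝ | ∀ i, δ * M < x i} := by
        rw [Set.ofPred_forall]
        exact MeasurableSet.iInter fun i => measurableSet_lt measurable_const (measurable_pi_apply i)
      have hCm : MeasurableSet {x : (R \ I : Finset ℕ) → ℝ | ε * M < ∑ j, min (x j) (δ * M)} :=
        measurableSet_lt measurable_const (by fun_prop)
      have h2 := measureReal_inter_blocks hmeas hindep
        (Finset.disjoint_sdiff : Disjoint I (R \ I)) hBm hCm
      have hBe : {ω | (fun i : I => ξ i ω) ∈ {x : I → ℝ | ∀ i, δ * M < x i}} = B I := by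
        ext ω; simp [B]
      have hCe : {ω | (fun j : (R \ I : Finset ℕ) => ξ j ω) ∈
          {x : (R \ I : Finset ℕ) → ℝ | ε * M < ∑ j, min (x j) (δ * M)}} = C (R \ I) := by
        ext ω
        have := Finset.sum_coe_sort (R \ I) fun j => min (ξ j ω) (δ * M)
        simp only [Set.mem_ofPred_eq, C]
        rw [this]
      rw [hBe, hCe] at h2
      rw [h2, measureReal_forall_lt hindep hident, hI.2]
      gcongr
      exact hτ _ Finset.sdiff_subset
    refine (Finset.sum_le_sum h1).trans ?_
    rw [Finset.sum_const, Finset.card_powersetCard, Finset.card_range, nsmul_eq_mul, mul_pow,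
      ← mul_assoc]
    gcongr
    exact hpow _
  have hR : P.real (C R) ≤ τ := hτ R subset_rfl
  have h1 := measureReal_mono (μ := P) hcover
  have h2 := measureReal_union_le (μ := P) ((⋃ I ∈ R.powersetCard k, A I) ∪
    (⋃ I ∈ R.powersetCard (k + 1), B I) ∪ C R) (⋃ I ∈ R.powersetCard k, B I ∩ C (R \ I))
  have h3 := measureReal_union_le (μ := P) ((⋃ I ∈ R.powersetCard k, A I) ∪
    (⋃ I ∈ R.powersetCard (k + 1), B I)) (C R)
  have h4 := measureReal_union_le (μ := P) (⋃ I ∈ R.powersetCard k, A I)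
    (⋃ I ∈ R.powersetCard (k + 1), B I)
  linarith

/-- Lower bound: exactly `k` large summands and a typical remainder. -/
theorem le_measureReal_lt_censoredSum (hmeas : ∀ j, Measurable (ξ j)) (hindep : iIndepFun ξ P)
    (hident : ∀ j, IdentDistrib (ξ j) (ξ 0) P P) (hL2 : MemLp (ξ 0) 2 P)
    (hmean : ∫ ω, ξ 0 ω ∂P = 0) (hvar : ∫ ω, (ξ 0 ω) ^ 2 ∂P = 1) {M δ ε z : ℝ} {k n : ℕ}
    (hM : 0 < M) (hε : 0 < ε) (hδ1 : δ ≤ 1) (hδz : δ ≤ z - (k - 1)) :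
    n.choose k * ((sumTail (P.map fun ω => min (ξ 0 ω / M) 1) k (z + ε)).toReal *
      (1 - n * rightTail P (ξ 0) (δ * M) - n / (ε * M) ^ 2)) ≤
      P.real {ω | z * M < censoredSum ξ M n ω} := by
  classical
  set V := rightTail P (ξ 0) (δ * M) with hV
  have hV0 : 0 ≤ V := measureReal_nonneg
  let R := Finset.range n
  let A : Finset ℕ → Set Ω := fun I => {ω | (z + ε) * M < ∑ i ∈ I, min (ξ i ω) M}
  let B : Finset ℕ → Set Ω := fun J => {ω | (∀ j ∈ J, ξ j ω ≤ δ * M) ∧ -(ε * M) < ∑ j ∈ J, ξ j ω}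
  have hδM : δ * M ≤ M := mul_le_of_le_one_left hM.le hδ1
  have hsub : (⋃ I ∈ R.powersetCard k, A I ∩ B (R \ I)) ⊆ {ω | z * M < censoredSum ξ M n ω} := by
    intro ω hω
    simp only [Set.mem_iUnion, Finset.mem_powersetCard, exists_prop] at hω
    obtain ⟨I, ⟨hIR, -⟩, h1 : (z + ε) * M < _, h2, h3⟩ := hω
    show z * M < ∑ j ∈ R, min (ξ j ω) M
    rw [← Finset.sum_sdiff hIR, Finset.sum_congr rfl fun j hj => min_eq_left ((h2 j hj).trans hδM)]
    linarith
  have hAmeas : ∀ I : Finset ℕ, MeasurableSet {x : ↥I → ℝ | (z + ε) * M < ∑ i, min (x i) M} :=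
    fun I => measurableSet_lt measurable_const (by fun_prop)
  have hBmeas : ∀ J : Finset ℕ, MeasurableSet {x : ↥J → ℝ |
      (∀ j, x j ≤ δ * M) ∧ -(ε * M) < ∑ j, x j} := fun J => by
    have h1 : MeasurableSet {x : ↥J → ℝ | ∀ j, x j ≤ δ * M} := by
      rw [Set.ofPred_forall]
      exact MeasurableSet.iInter fun i => measurableSet_le (measurable_pi_apply i) measurable_const
    have h2 : MeasurableSet {x : ↥J → ℝ | -(ε * M) < ∑ j, x j} :=
      measurableSet_lt measurable_const (by fun_prop)
    exact h1.inter h2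
  have hAe : ∀ I : Finset ℕ, {ω | (fun i : I => ξ i ω) ∈
      {x : I → ℝ | (z + ε) * M < ∑ i, min (x i) M}} = A I := fun I => by
    ext ω
    have := Finset.sum_coe_sort I fun j => min (ξ j ω) M
    simp only [Set.mem_ofPred_eq, A]
    rw [this]
  have hBe : ∀ J : Finset ℕ, {ω | (fun j : J => ξ j ω) ∈
      {x : J → ℝ | (∀ j, x j ≤ δ * M) ∧ -(ε * M) < ∑ j, x j}} = B J := fun J => by
    ext ω
    have := Finset.sum_coe_sort J fun j => ξ j ω
    simp only [Set.mem_ofPred_eq, B]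
    rw [this]
    simp
  have hvec : ∀ I : Finset ℕ, Measurable fun ω => fun i : I => ξ i ω := fun I =>
    measurable_pi_lambda _ fun i => hmeas i
  have hAm : ∀ I, MeasurableSet (A I) := fun I => by
    rw [← hAe]; exact hvec I (hAmeas I)
  have hBm : ∀ I, MeasurableSet (B I) := fun I => by
    rw [← hBe]; exact hvec I (hBmeas I)
  have hdisj : (R.powersetCard k : Set (Finset ℕ)).PairwiseDisjoint fun I => A I ∩ B (R \ I) := by
    -- The outcome determines `I`: on `A I` each chosen summand exceeds `δ * M`, because `δ ≤ z - (k
    -- - 1)`, while on `B (R \ I)` no other one does. Hence the probabilities add exactly.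
    have key : ∀ I ∈ R.powersetCard k, ∀ ω ∈ A I ∩ B (R \ I),
        I = R.filter fun j => δ * M < ξ j ω := by
      intro I hI ω hω
      rw [Finset.mem_powersetCard] at hI
      obtain ⟨h1, h2, -⟩ := hω
      ext j
      rw [Finset.mem_filter]
      refine ⟨fun hj => ⟨hI.1 hj, ?_⟩, fun hj => ?_⟩
      · have h3 := card_mul_lt_of_lt_sum_min hI.2 h1 hj
        have h4 : δ * M ≤ (z + ε - (k - 1)) * M := by
          gcongr
          linarith
        exact h4.trans_lt h3
      · by_contra hc
        exact absurd (h2 j (Finset.mem_sdiff.2 ⟨hj.1, hc⟩)) (not_le.2 hj.2)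
    intro I hI J hJ hIJ
    refine Set.disjoint_left.2 fun ω h1 h2 => hIJ ?_
    rw [key I hI ω h1]
    exact (key J hJ ω h2).symm
  have hBlow : ∀ J ⊆ R, 1 - n * V - n / (ε * M) ^ 2 ≤ P.real (B J) := by
    intro J hJ
    have hcard : (J.card : ℝ) ≤ n := by
      have := Finset.card_le_card hJ
      rw [Finset.card_range] at this
      exact_mod_cast this
    have h1 : P.real (B J)ᶜ ≤ n * V + n / (ε * M) ^ 2 := by
      have hc : (B J)ᶜ ⊆ (⋃ j ∈ J, {ω | δ * M < ξ j ω}) ∪ {ω | ∑ j ∈ J, ξ j ω ≤ -(ε * M)} := by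
        intro ω hω
        by_contra hcon
        simp only [Set.mem_union, Set.mem_iUnion, exists_prop, Set.mem_ofPred_eq, not_or, not_exists,
          not_and, not_lt, not_le] at hcon
        exact hω ⟨hcon.1, hcon.2⟩
      refine (measureReal_mono hc).trans ((measureReal_union_le _ _).trans (add_le_add ?_ ?_))
      · refine (measureReal_biUnion_finset_le _ _).trans ?_
        have h2 : ∀ j ∈ J, P.real {ω | δ * M < ξ j ω} = V := fun j _ => rightTail_eq hident j _
        rw [Finset.sum_congr rfl h2, Finset.sum_const, nsmul_eq_mul]
        gcongr
      · refine (measureReal_sum_le_neg_le hindep hident hL2 hmean hvar (by positivity) J).trans ?_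
        gcongr
    rw [probReal_compl_eq_one_sub (hBm J)] at h1
    linarith
  refine le_trans ?_ (measureReal_mono hsub)
  rw [measureReal_biUnion_finset hdisj fun I _ => (hAm I).inter (hBm _)]
  have hterm : ∀ I ∈ R.powersetCard k,
      (sumTail (P.map fun ω => min (ξ 0 ω / M) 1) k (z + ε)).toReal *
        (1 - n * V - n / (ε * M) ^ 2) ≤ P.real (A I ∩ B (R \ I)) := by
    intro I hI
    rw [Finset.mem_powersetCard] at hI
    have h2 := measureReal_inter_blocks hmeas hindep
      (Finset.disjoint_sdiff : Disjoint I (R \ I)) (hAmeas I) (hBmeas _)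
    rw [hAe, hBe] at h2
    rw [h2, ← hI.2, ← measureReal_lt_sum_min_eq hmeas hindep hident hM]
    gcongr
    exact hBlow _ Finset.sdiff_subset
  refine le_trans (le_of_eq ?_) (Finset.sum_le_sum hterm)
  rw [Finset.sum_const, Finset.card_powersetCard, Finset.card_range, nsmul_eq_mul]

end IID

/-! ### Negligibility of sums of small summands. -/

/-- With Chernoff parameter `l = c log M / M`, the bound on the moment generating function costs at
most one factor `M n`. The quadratic part is `o(log M)` by `hnlog`; the tail part tends to `0`
because `c * δ` is small. -/
theorem eventually_chernoff_exponent_le {V : ℝ → ℝ} {β : ℝ} (hβ : 2 < β)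
    (hV : ∀ᶠ t in atTop, V t ≤ t ^ (-β)) {M : ℕ → ℝ} (hMt : Tendsto M atTop atTop)
    (hnlog : Tendsto (fun n : ℕ => n * Real.log (M n) / M n ^ 2) atTop (𝓝 0))
    (hn : Tendsto (fun n : ℕ => n / M n ^ 2) atTop (𝓝 0)) {c δ : ℝ} (hc : 0 < c)
    (hδ : c * δ ≤ (β - 2) / 2) :
    ∀ᶠ n : ℕ in atTop, n * ((c * Real.log (M n) / M n) ^ 2 +
      Real.exp (c * Real.log (M n) / M n * (δ * M n)) * V (1 / (c * Real.log (M n) / M n))) ≤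
        Real.log (M n) := by
  have hlog : Tendsto (fun n => Real.log (M n)) atTop atTop := Real.tendsto_log_atTop.comp hMt
  have hl0 : Tendsto (fun n => c * Real.log (M n) / M n) atTop (𝓝[>] 0) := by
    refine tendsto_nhdsWithin_iff.2 ⟨?_, ?_⟩
    · have := ((Real.isLittleO_log_id_atTop.tendsto_div_nhds_zero).comp hMt).const_mul c
      rw [mul_zero] at this
      refine this.congr fun n => ?_
      simp only [Function.comp, id, mul_div_assoc]
    · filter_upwards [hlog.eventually_gt_atTop 0, hMt.eventually_gt_atTop 0] with n h1 h2
      simp only [Set.mem_Ioi]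
      positivity
  have hinv : Tendsto (fun n => 1 / (c * Real.log (M n) / M n)) atTop atTop := by
    simp only [one_div]
    exact tendsto_inv_nhdsGT_zero.comp hl0
  have hκ : 0 < (β - 2) / 2 := by linarith
  have h2 : Tendsto (fun n : ℕ => n / M n ^ 2 *
      (c ^ β * (Real.log (M n) ^ β / M n ^ ((β - 2) / 2)))) atTop (𝓝 0) := by
    have h3 := ((isLittleO_log_rpow_rpow_atTop β hκ).tendsto_div_nhds_zero).comp hMt
    have h4 := hn.mul (h3.const_mul (c ^ β))
    rw [mul_zero, mul_zero] at h4
    exact h4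
  have h1 : Tendsto (fun n : ℕ => c ^ 2 * (n * Real.log (M n) / M n ^ 2)) atTop (𝓝 0) := by
    have := hnlog.const_mul (c ^ 2)
    rwa [mul_zero] at this
  filter_upwards [hinv.eventually hV, hlog.eventually_ge_atTop 1, hMt.eventually_ge_atTop 1,
    h1.eventually (gt_mem_nhds (show (0 : ℝ) < 1 / 2 by norm_num)),
    h2.eventually (gt_mem_nhds (show (0 : ℝ) < 1 / 2 by norm_num))] with n hVn hl hM1 hA hB
  have hM0 : 0 < M n := by linarith
  have hl' : 0 < Real.log (M n) := by linarith
  have e1 : (n : ℝ) * (c * Real.log (M n) / M n) ^ 2 =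
      c ^ 2 * (n * Real.log (M n) / M n ^ 2) * Real.log (M n) := by
    field_simp
  have e2 : Real.exp (c * Real.log (M n) / M n * (δ * M n)) ≤ M n ^ ((β - 2) / 2) := by
    rw [Real.rpow_def_of_pos hM0]
    refine Real.exp_le_exp.2 ?_
    calc c * Real.log (M n) / M n * (δ * M n) = Real.log (M n) * (c * δ) := by field_simp
      _ ≤ _ := by gcongr
  have e3 : (1 / (c * Real.log (M n) / M n)) ^ (-β) = c ^ β * Real.log (M n) ^ β / M n ^ β := by
    rw [one_div, Real.inv_rpow (by positivity), Real.rpow_neg (by positivity), inv_inv,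
      Real.div_rpow (by positivity) hM0.le, Real.mul_rpow hc.le hl'.le]
  -- One factor `M ^ ((β - 2) / 2)` cancels the exponential bounded in `e2`, the other beats the
  -- power of the logarithm, and `M ^ 2` is paired with `n`.
  have e4 : M n ^ β = M n ^ ((β - 2) / 2) * M n ^ ((β - 2) / 2) * M n ^ 2 := by
    rw [← Real.rpow_add hM0, ← Real.rpow_natCast (M n) 2, ← Real.rpow_add hM0]
    congr 1
    push_cast
    ring
  have e5 : (n : ℝ) * (Real.exp (c * Real.log (M n) / M n * (δ * M n)) *
      V (1 / (c * Real.log (M n) / M n))) ≤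
      n / M n ^ 2 * (c ^ β * (Real.log (M n) ^ β / M n ^ ((β - 2) / 2))) := by
    have hp : 0 < M n ^ ((β - 2) / 2) := by positivity
    calc _ ≤ (n : ℝ) * (M n ^ ((β - 2) / 2) * (c ^ β * Real.log (M n) ^ β / M n ^ β)) := by
          rw [e3] at hVn
          have hpos : 0 ≤ c ^ β * Real.log (M n) ^ β / M n ^ β := by positivity
          exact mul_le_mul_of_nonneg_left ((mul_le_mul_of_nonneg_left hVn (Real.exp_pos _).le).trans
            (mul_le_mul_of_nonneg_right e2 hpos)) (Nat.cast_nonneg n)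
      _ = _ := by
          rw [e4]
          field_simp
  rw [mul_add, e1]
  nlinarith

section IID
variable {Ω : Type*} [MeasurableSpace Ω] {P : Measure Ω} [IsProbabilityMeasure P] {ξ : ℕ → Ω → ℝ}

/-- Sums of summands truncated at a small multiple of `M n` exceed `ε M n` with probability
smaller than any prescribed power of `M n`. -/
theorem exists_eventually_lt_sum_min_le_rpow (hmeas : ∀ j, Measurable (ξ j))
    (hindep : iIndepFun ξ P) (hident : ∀ j, IdentDistrib (ξ j) (ξ 0) P P)
    (hL2 : MemLp (ξ 0) 2 P) (hmean : ∫ ω, ξ 0 ω ∂P = 0) (hvar : ∫ ω, (ξ 0 ω) ^ 2 ∂P = 1) {β : ℝ}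
    (hβ : 2 < β) (hV : ∀ᶠ t in atTop, rightTail P (ξ 0) t ≤ t ^ (-β)) {M : ℕ → ℝ}
    (hMt : Tendsto M atTop atTop)
    (hnlog : Tendsto (fun n : ℕ => n * Real.log (M n) / M n ^ 2) atTop (𝓝 0))
    (hn : Tendsto (fun n : ℕ => n / M n ^ 2) atTop (𝓝 0)) {ε K : ℝ} (hε : 0 < ε) (hK : 0 < K) :
    ∃ δ : ℝ, 0 < δ ∧ δ ≤ 1 ∧ ∀ᶠ n in atTop, ∀ J ⊆ Finset.range n,
      P.real {ω | ε * M n < ∑ j ∈ J, min (ξ j ω) (δ * M n)} ≤ M n ^ (-K) := by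
  have hc : 0 < (K + 1) / ε := by positivity
  have hκ : 0 < (β - 2) / 2 := by linarith
  -- With this `c` the factor `exp (-l * ε * M)` is `M ^ (-(K + 1))`; the extra `1` pays for the
  -- factor `M` from `eventually_chernoff_exponent_le`.
  set c := (K + 1) / ε with hcdef
  refine ⟨min 1 ((β - 2) / 2 / c), by positivity, min_le_left _ _, ?_⟩
  set δ := min 1 ((β - 2) / 2 / c) with hδ
  have hcδ : c * δ ≤ (β - 2) / 2 := by
    have := min_le_right 1 ((β - 2) / 2 / c)
    rw [← hδ, le_div_iff₀ hc] at this
    linarith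
  have hδ0 : 0 < δ := by positivity
  filter_upwards [eventually_chernoff_exponent_le hβ hV hMt hnlog hn hc hcδ,
    hMt.eventually_gt_atTop 1] with n h1 hM1 J hJ
  have hM0 : 0 < M n := by linarith
  have hl : 0 < Real.log (M n) := Real.log_pos hM1
  have h2 := measureReal_lt_sum_min_le hmeas hindep hident hL2 hmean hvar
    (y := δ * M n) (l := c * Real.log (M n) / M n) (by positivity) (by positivity) (ε * M n) J
  refine h2.trans ?_
  rw [← Real.exp_add, Real.rpow_def_of_pos hM0]
  refine Real.exp_le_exp.2 ?_
  have hcard : (J.card : ℝ) ≤ n := by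
    have := Finset.card_le_card hJ
    rw [Finset.card_range] at this
    exact_mod_cast this
  have h3 : -(c * Real.log (M n) / M n) * (ε * M n) = -((K + 1) * Real.log (M n)) := by
    rw [hcdef]; field_simp
  have h4 : 0 ≤ (c * Real.log (M n) / M n) ^ 2 + Real.exp (c * Real.log (M n) / M n * (δ * M n)) *
      rightTail P (ξ 0) (1 / (c * Real.log (M n) / M n)) := by
    have : 0 ≤ rightTail P (ξ 0) (1 / (c * Real.log (M n) / M n)) := measureReal_nonneg
    positivity
  have h5 := mul_le_mul_of_nonneg_right hcard h4
  rw [h3]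
  linarith

/-! ### The pointwise limit. -/

/-- The probability of `Y_n > z M_n`, normalized by `Π_n ^ k / k!`. -/
noncomputable def normalizedTail (P : Measure Ω) (ξ : ℕ → Ω → ℝ) (M : ℕ → ℝ) (k n : ℕ) (z : ℝ) : ℝ :=
  P.real {ω | z * M n < censoredSum ξ (M n) n ω} /
    ((n * rightTail P (ξ 0) (M n)) ^ k / k.factorial)

/-- The remainder shifts the threshold slightly: the lower bound is compared with the limit at some
`y > z`, the upper bound with some `y < z`, and continuity of `simplexSum` closes the gap. -/
theorem tendsto_normalizedTail (hmeas : ∀ j, Measurable (ξ j))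
    (hindep : iIndepFun ξ P) (hident : ∀ j, IdentDistrib (ξ j) (ξ 0) P P)
    (hL2 : MemLp (ξ 0) 2 P) (hmean : ∫ ω, ξ 0 ω ∂P = 0) (hvar : ∫ ω, (ξ 0 ω) ^ 2 ∂P = 1)
    {α : ℝ} (hα : 2 < α) (hVpos : ∀ t, 0 < rightTail P (ξ 0) t)
    (hVreg : ∀ y, 0 < y → Tendsto (fun t => rightTail P (ξ 0) (t * y) / rightTail P (ξ 0) t) atTop
      (𝓝 (y ^ (-α))))
    {M : ℕ → ℝ} (hMt : Tendsto M atTop atTop)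
    (hnlog : Tendsto (fun n : ℕ => n * Real.log (M n) / M n ^ 2) atTop (𝓝 0))
    (hn : Tendsto (fun n : ℕ => n / M n ^ 2) atTop (𝓝 0)) {k : ℕ} (hk : 1 ≤ k) {z : ℝ}
    (hz : z ∈ Set.Ioo ((k : ℝ) - 1) k) :
    Tendsto (fun n => normalizedTail P ξ M k n z) atTop (𝓝 (simplexSum α k z)) := by
  have hα0 : 0 < α := by linarith
  set V := rightTail P (ξ 0) with hV
  have hVanti : Antitone V := antitone_rightTail _
  -- The exponent is the midpoint of `2` and `α`: below `α` for the Potter bound, above `2` for the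
  -- Chernoff estimate.
  have hVupper : ∀ᶠ t in atTop, V t ≤ t ^ (-((α + 2) / 2)) :=
    eventually_le_rpow_of_doubling hVanti (fun t _ => hVpos t) (hVreg 2 two_pos) (by linarith)
      (by linarith)
  have hVlower : ∀ᶠ t in atTop, t ^ (-(α + 1)) ≤ V t :=
    eventually_rpow_le_of_doubling hVanti (fun t _ => hVpos t) (hVreg 2 two_pos) hα0 (by linarith)
  have hPi : Tendsto (fun n : ℕ => n * V (M n)) atTop (𝓝 0) := by
    refine squeeze_zero' (Eventually.of_forall fun n => ?_) ?_ hn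
    · have := (hVpos (M n)).le
      positivity
    · filter_upwards [hMt.eventually hVupper, hMt.eventually_ge_atTop 1] with n h1 h2
      have h0 : 0 < M n := by linarith
      rw [div_eq_mul_inv]
      gcongr
      refine h1.trans ?_
      rw [← Real.rpow_natCast, ← Real.rpow_neg h0.le]
      refine Real.rpow_le_rpow_of_exponent_le h2 ?_
      push_cast
      linarith
  have hratio : ∀ y, 0 < y → Tendsto (fun n => V (y * M n) / V (M n)) atTop (𝓝 (y ^ (-α))) := by
    intro y hy
    refine ((hVreg y hy).comp hMt).congr fun n => ?_
    simp only [Function.comp_apply, mul_comm y]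
  have hphi : ∀ m : ℝ, Measurable fun ω => min (ξ 0 ω / m) 1 := fun m =>
    ((hmeas 0).div_const m).min measurable_const
  let ν : ℕ → Measure ℝ := fun n => P.map fun ω => min (ξ 0 ω / M n) 1
  have hνp : ∀ n, IsProbabilityMeasure (ν n) := fun n =>
    Measure.isProbabilityMeasure_map (hphi _).aemeasurable
  have hν1 : ∀ n, ν n (Set.Ioi 1) = 0 := fun n => by
    have h1 : (fun ω => min (ξ 0 ω / M n) 1) ⁻¹' Set.Ioi 1 = ∅ :=
      Set.eq_empty_of_forall_notMem fun ω (hω : 1 < min (ξ 0 ω / M n) 1) =>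
        absurd hω (not_lt.2 (min_le_right _ _))
    rw [Measure.map_apply (hphi _) measurableSet_Ioi, h1, measure_empty]
  have hνlim : ∀ t ∈ Set.Ioo (0 : ℝ) 1,
      Tendsto (fun n => (ν n).real (Set.Ioi t) / V (M n)) atTop (𝓝 (t ^ (-α))) := by
    intro t ht
    refine (hratio t ht.1).congr' ?_
    filter_upwards [hMt.eventually_gt_atTop 0] with n h0
    congr 1
    rw [map_measureReal_apply (hphi _) measurableSet_Ioi]
    show P.real _ = P.real _
    congr 1
    ext ω
    simp only [Set.mem_preimage, Set.mem_ofPred_eq, Set.mem_Ioi, lt_min_iff, ht.2, and_true]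
    exact (lt_div_iff₀ h0).symm
  have hT : ∀ y ∈ Set.Ioo ((k : ℝ) - 1) k,
      Tendsto (fun n => (sumTail (ν n) k y).toReal / V (M n) ^ k) atTop (𝓝 (simplexSum α k y)) :=
    fun y hy => tendsto_sumTail_div_pow hα0 hνp hν1
      (Eventually.of_forall fun n => hVpos _) hνlim hy
  have hchoose : Tendsto (fun n : ℕ => (n.choose k : ℝ) / (n ^ k / k.factorial)) atTop (𝓝 1) := by
    refine (Asymptotics.isEquivalent_iff_tendsto_one ?_).1 (isEquivalent_choose k)
    filter_upwards [eventually_gt_atTop 0] with n h0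
    have : (0 : ℝ) < n := by exact_mod_cast h0
    positivity
  have hcont := (continuousOn_simplexSum hα0 k).continuousAt (isOpen_Ioo.mem_nhds hz)
  have hk0 : (k.factorial : ℝ) ≠ 0 := by positivity
  refine tendsto_order.2 ⟨fun b hb => ?_, fun b hb => ?_⟩
  · have hnear : ∀ᶠ y in 𝓝[>] z, b < simplexSum α k y ∧ y ∈ Set.Ioo ((k : ℝ) - 1) k :=
      nhdsWithin_le_nhds ((hcont.eventually (lt_mem_nhds hb)).and (isOpen_Ioo.mem_nhds hz))
    obtain ⟨y, ⟨hyb, hy⟩, hzy : z < y⟩ := (hnear.and self_mem_nhdsWithin).exists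
    set δ := z - (k - 1) with hδ
    have hδ0 : 0 < δ := by linarith [hz.1]
    have hδ1 : δ ≤ 1 := by linarith [hz.2]
    have hrest : Tendsto (fun n : ℕ => 1 - n * V (δ * M n) - n / ((y - z) * M n) ^ 2) atTop
        (𝓝 1) := by
      have h1 : Tendsto (fun n : ℕ => n * V (δ * M n)) atTop (𝓝 0) := by
        have := hPi.mul (hratio δ hδ0)
        rw [zero_mul] at this
        refine this.congr fun n => ?_
        have := (hVpos (M n)).ne'
        field_simp
      have h2 : Tendsto (fun n : ℕ => n / ((y - z) * M n) ^ 2) atTop (𝓝 0) := by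
        have := hn.const_mul (((y - z) ^ 2)⁻¹)
        rw [mul_zero] at this
        refine this.congr fun n => ?_
        rw [mul_pow, ← div_div, div_right_comm, div_eq_inv_mul _ ((y - z) ^ 2)]
      simpa using (tendsto_const_nhds.sub h1).sub h2
    have hlow := (hchoose.mul (hT y hy)).mul hrest
    rw [one_mul, mul_one] at hlow
    filter_upwards [hlow.eventually (lt_mem_nhds hyb), hMt.eventually_gt_atTop 0,
      eventually_gt_atTop 0] with n h1 hM0 hn0
    refine h1.trans_le ?_
    have hn0' : (0 : ℝ) < n := by exact_mod_cast hn0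
    have hV0 := hVpos (M n)
    have h2 := le_measureReal_lt_censoredSum (z := z) (k := k) (n := n) (δ := δ) hmeas hindep hident
      hL2 hmean hvar hM0 (sub_pos.2 hzy) hδ1 le_rfl
    rw [add_sub_cancel] at h2
    rw [normalizedTail, le_div_iff₀ (by positivity)]
    refine le_trans (le_of_eq ?_) h2
    simp only [ν]
    rw [← hV]
    generalize 1 - n * V (δ * M n) - n / ((y - z) * M n) ^ 2 = q
    rw [mul_pow]
    field_simp
  · have hnear : ∀ᶠ y in 𝓝[<] z, simplexSum α k y < b ∧ y ∈ Set.Ioo ((k : ℝ) - 1) k :=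
      nhdsWithin_le_nhds ((hcont.eventually (gt_mem_nhds hb)).and (isOpen_Ioo.mem_nhds hz))
    obtain ⟨y, ⟨hyb, hy⟩, hzy : y < z⟩ := (hnear.and self_mem_nhdsWithin).exists
    obtain ⟨δ, hδ0, hδ1, hτ⟩ := exists_eventually_lt_sum_min_le_rpow hmeas hindep hident hL2 hmean
      hvar (show 2 < (α + 2) / 2 by linarith) hVupper hMt hnlog hn (sub_pos.2 hzy)
      (show 0 < k * (α + 1) + 1 by positivity)
    -- For large `n`, `Π_n ^ k` is at least `M ^ (-k * (α + 1))`, so this `K` makes the Chernoff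
    -- error at most `1 / M` relative to it.
    set K := k * (α + 1) + 1 with hK
    have hr := hratio δ hδ0
    have hτ0 : Tendsto (fun n => M n ^ (-K)) atTop (𝓝 0) :=
      (tendsto_rpow_neg_atTop (show 0 < K by positivity)).comp hMt
    have hquot : Tendsto (fun n : ℕ => M n ^ (-K) / (n * V (M n)) ^ k) atTop (𝓝 0) := by
      refine squeeze_zero' ?_ ?_ (tendsto_inv_atTop_zero.comp hMt)
      · filter_upwards [hMt.eventually_gt_atTop 0] with n h0
        have := hVpos (M n)
        positivity
      · filter_upwards [hMt.eventually_gt_atTop 0, hMt.eventually hVlower, eventually_ge_atTop 1]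
          with n h0 h1 hn1
        have hn1' : (1 : ℝ) ≤ n := by exact_mod_cast hn1
        have hV0 := hVpos (M n)
        simp only [Function.comp]
        rw [div_le_iff₀ (by positivity)]
        have h2 : M n ^ (-(α + 1)) ≤ n * V (M n) := h1.trans (le_mul_of_one_le_left hV0.le hn1')
        calc M n ^ (-K) = (M n)⁻¹ * (M n ^ (-(α + 1))) ^ k := by
              rw [← Real.rpow_natCast, ← Real.rpow_mul h0.le, ← Real.rpow_neg_one (M n),
                ← Real.rpow_add h0]
              congr 1
              rw [hK]
              ring
          _ ≤ _ := by gcongr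
    -- The four terms match those of `measureReal_lt_censoredSum_le` after division by `Π_n ^ k /
    -- k!`; only the first survives.
    have hup := (((hchoose.mul (hT y hy)).add ((((hr.pow (k + 1)).mul hPi)).const_mul
      (k.factorial : ℝ))).add (hquot.const_mul (k.factorial : ℝ))).add
        (((hr.pow k).mul hτ0).const_mul (k.factorial : ℝ))
    simp only [mul_zero, add_zero, one_mul] at hup
    filter_upwards [hup.eventually (gt_mem_nhds hyb), hMt.eventually_gt_atTop 0,
      eventually_gt_atTop 0, hτ] with n h1 hM0 hn0 hτn
    refine lt_of_le_of_lt ?_ h1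
    have hn0' : (0 : ℝ) < n := by exact_mod_cast hn0
    have hV0 := hVpos (M n)
    have h2 := measureReal_lt_censoredSum_le (z := z) (k := k) (n := n) (δ := δ) (ε := z - y)
      hmeas hindep hident hM0 hδ0.le hδ1 hk (by linarith [hy.1]) hτn
    rw [sub_sub_cancel] at h2
    rw [normalizedTail, div_le_iff₀ (by positivity)]
    refine h2.trans (le_of_eq ?_)
    simp only [ν]
    rw [← hV]
    generalize V (δ * M n) = v
    generalize M n ^ (-K) = τ
    simp only [mul_pow, div_pow, pow_succ]
    field_simp

end IID

/-! ### Uniformity in `x`. -/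

theorem theorem3 {Ω : Type*} [MeasurableSpace Ω] (P : Measure Ω) [IsProbabilityMeasure P]
    (ξ : ℕ → Ω → ℝ)
    (hmeas : ∀ j, Measurable (ξ j))
    (hindep : iIndepFun ξ P)
    (hident : ∀ j, IdentDistrib (ξ j) (ξ 0) P P)
    (hL2 : MemLp (ξ 0) 2 P)
    (hmean : ∫ ω, ξ 0 ω ∂P = 0)
    (hvar : ∫ ω, (ξ 0 ω) ^ 2 ∂P = 1)
    (α : ℝ) (hα : 2 < α)
    (L : ℝ → ℝ) (hL : SlowlyVarying L)
    (hV : ∀ t : ℝ, 0 < t → rightTail P (ξ 0) t = t ^ (-α) * L t)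
    (M : ℕ → ℝ) (hM : Tendsto (fun n => M n / sScale α n) atTop atTop)
    (k : ℕ) (hk : 2 ≤ k) :
    ∃ h₀ : ℕ → ℝ, (∀ n, 0 < h₀ n) ∧ Tendsto h₀ atTop (𝓝 0) ∧
      ∀ h : ℕ → ℝ, Tendsto h atTop (𝓝 0) → (∀ᶠ n in atTop, h₀ n ≤ h n) →
        UniformlyEquivalent
          (fun n x => P.real {ω | x < censoredSum ξ (M n) n ω})
          (fun n x => ((n : ℝ) * rightTail P (ξ 0) (M n)) ^ k / (k.factorial : ℝ) *
            ∑ j ∈ Finset.range (k + 1),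
              (k.choose j : ℝ) * simplexW α (k - j) (x / M n - (j : ℝ)))
          (fun n => Set.Ioo (((k : ℝ) - 1 + h n) * M n) (((k : ℝ) - h n) * M n)) := by
  have hα0 : 0 < α := by linarith
  have hMt := tendsto_level_atTop hα hM
  have hVpos := hL.tail_pos hV (antitone_rightTail (ξ 0)) fun _ => measureReal_nonneg
  have hpt : ∀ z ∈ Set.Ioo ((k : ℝ) - 1) k,
      Tendsto (fun n => normalizedTail P ξ M k n z) atTop (𝓝 (simplexSum α k z)) := fun z hz =>
    tendsto_normalizedTail hmeas hindep hident hL2 hmean hvar hα hVpos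
      (fun y hy => hL.tendsto_tail_ratio hV hy) hMt (tendsto_mul_log_div_sq hα hM)
      (tendsto_natCast_div_sq hα hM) (by omega) hz
  have hanti : ∀ᶠ n in atTop, Antitone (normalizedTail P ξ M k n) := by
    filter_upwards [hMt.eventually_gt_atTop 0] with n hM0 a b hab
    have hV0 := hVpos (M n)
    have h1 : P.real {ω | b * M n < censoredSum ξ (M n) n ω} ≤
        P.real {ω | a * M n < censoredSum ξ (M n) n ω} := measureReal_mono fun ω hω =>
      lt_of_le_of_lt (mul_le_mul_of_nonneg_right hab hM0.le) hω
    unfold normalizedTail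
    exact div_le_div_of_nonneg_right h1 (by positivity)
  have hunif : ∀ i : ℕ, ∀ᶠ n in atTop, ∀ z ∈ Set.Icc ((k : ℝ) - 1 + 1 / ((i : ℝ) + 1))
      (k - 1 / ((i : ℝ) + 1)), |normalizedTail P ξ M k n z - simplexSum α k z| ≤ 1 / ((i : ℝ) + 1) := by
    intro i
    have hi : (0 : ℝ) < 1 / ((i : ℝ) + 1) := Nat.one_div_pos_of_nat
    have h1 := tendstoUniformlyOn_Icc_of_antitone hanti hpt (continuousOn_simplexSum hα0 k)
      (show (k : ℝ) - 1 < k - 1 + 1 / ((i : ℝ) + 1) by linarith)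
      (show (k : ℝ) - 1 / ((i : ℝ) + 1) < k by linarith)
    filter_upwards [Metric.tendstoUniformlyOn_iff.1 h1 _ hi] with n hn z hz
    have := hn z hz
    rw [dist_comm, Real.dist_eq] at this
    exact this.le
  -- The index `i n` grows slowly enough for the uniform bound to hold along it; `1 / (i n + 1)` is
  -- both the margin at the endpoints and the error bound.
  obtain ⟨i, hi, hin⟩ := exists_tendsto_atTop_eventually_diagonal hunif
  have hlim : Tendsto (fun n => 1 / ((i n : ℝ) + 1)) atTop (𝓝 0) :=
    tendsto_one_div_add_atTop_nhds_zero_nat.comp hi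
  refine ⟨fun n => 1 / ((i n : ℝ) + 1), fun n => Nat.one_div_pos_of_nat, hlim, ?_⟩
  intro h _ hh ε hε
  filter_upwards [hin, hh, hlim.eventually (gt_mem_nhds hε), hMt.eventually_gt_atTop 0,
    eventually_gt_atTop 0] with n h1 h2 h3 hM0 hn0 x hx
  have hn0' : (0 : ℝ) < n := by exact_mod_cast hn0
  have hV0 := hVpos (M n)
  have hzl : (k : ℝ) - 1 + h n < x / M n := by rw [lt_div_iff₀ hM0]; exact hx.1
  have hzr : x / M n < k - h n := by rw [div_lt_iff₀ hM0]; exact hx.2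
  have h0 : (0 : ℝ) < 1 / ((i n : ℝ) + 1) := Nat.one_div_pos_of_nat
  have h4 := h1 (x / M n) ⟨by linarith, by linarith⟩
  have hG : 1 ≤ simplexSum α k (x / M n) := one_le_simplexSum hα0 (by linarith) (by linarith)
  have hG0 : 0 < simplexSum α k (x / M n) := by linarith
  -- The relative error is the absolute error of the normalized tail divided by a limit that is at
  -- least `1`.
  have h5 : P.real {ω | x < censoredSum ξ (M n) n ω} /
      ((n * rightTail P (ξ 0) (M n)) ^ k / k.factorial * simplexSum α k (x / M n)) - 1 =
      (normalizedTail P ξ M k n (x / M n) - simplexSum α k (x / M n)) /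
        simplexSum α k (x / M n) := by
    rw [normalizedTail, div_mul_cancel₀ _ hM0.ne', ← div_div, sub_div, div_self hG0.ne']
  show |P.real {ω | x < censoredSum ξ (M n) n ω} /
      ((n * rightTail P (ξ 0) (M n)) ^ k / k.factorial * simplexSum α k (x / M n)) - 1| ≤ ε
  rw [h5, abs_div, abs_of_pos hG0]
  exact (div_le_self (abs_nonneg _) hG).trans (h4.trans h3.le)
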